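/- Conventions. For a $C^*$-algebra $A$, $M(A)$ is its multiplier algebra. An endomorphism $\alpha$ of $A$ is \emph{extendible} if it extends to a strictly continuous endomorphism $\overline\alpha$ of $M(A)$ (not necessarily unital). An \emph{Exel system} $(A,\alpha,L)$ consists of a (possibly non-unital) $C^*$-algebra $A$, an extendible endomorphism $\alpha$ of $A$, and a positive linear map $L:A\to A$ that extends to a positive linear map $\overline L:M(A)\to M(A)$ with $L(\alpha(a)m)=a\overline L(m)$ for $a\in A$, $m\in M(A)$, and $\overline L(1)=1$. Let $M_L$ be the right-Hilbert $A$-bimodule obtained from $A$, with $a\cdot m=am$, $m\cdot b=m\alpha(b)$ and $\langle m,n\rangle=L(m^*n)$, by dividing out the vectors of length zero and completing; let $q:A\to M_L$ be the canonical map, $\phi(a)$ the operator of left multiplication by $a$ on $M_L$, and $\mathcal K(M_L)$ the closed span of the operators $\Theta_{m,n}:p\mapsto m\cdot\langle n,p\rangle$. A \emph{Toeplitz-covariant representation} of $(A,\alpha,L)$ in a $C^*$-algebra $B$ is a pair $(\pi,S)$ of a nondegenerate homomorphism $\pi:A\to B$ and an element $S\in M(B)$ with $S\pi(a)=\pi(\alpha(a))S$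 and $S^*\pi(a)S=\pi(L(a))$ for all $a\in A$. Let $\mathcal T(A,\alpha,L)$ be the $C^*$-algebra generated by $i(A)\cup i(A)s$ for a universal Toeplitz-covariant representation $(i,s)$, let $\psi_s:M_L\to\mathcal T(A,\alpha,L)$ be the bounded linear map with $\psi_s(q(a))=i(a)s$, let $(\psi_s,i)^{(1)}:\mathcal K(M_L)\to\mathcal T(A,\alpha,L)$ be the homomorphism with $\Theta_{m,n}\mapsto\psi_s(m)\psi_s(n)^*$, and let $K_\alpha:=\overline{A\alpha(A)A}\cap\phi^{-1}(\mathcal K(M_L))$, where $\overline{A\alpha(A)A}$ is the closed span of the products. The \emph{Exel crossed product} $A\rtimes_{\alpha,L}\mathbb N$ is the quotient of $\mathcal T(A,\alpha,L)$ by the closed ideal generated by $\{i(a)-(\psi_s,i)^{(1)}(\phi(a)):a\in K_\alpha\}$. Let $j:A\to A\rtimes_{\alpha,L}\mathbb N$ and $t\in M(A\rtimes_{\alpha,L}\mathbb N)$ be the images of $i$ and $s$, and let $\hat\alpha$ be the dual action of $\mathbb T$ on $A\rtimes_{\alpha,L}\mathbb N$, given by $\hat\alpha_z(j(a))=j(a)$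 and $\hat\alpha_z(j(a)t)=z\,j(a)t$, with fixed-point algebra $(A\rtimes_{\alpha,L}\mathbb N)^{\hat\alpha}$. For an endomorphism $\beta$ of a $C^*$-algebra $B$, a \emph{Stacey-covariant representation} of $(B,\beta)$ in a $C^*$-algebra $D$ is a pair $(\pi,V)$ of a nondegenerate homomorphism $\pi:B\to D$ and an isometry $V\in M(D)$ with $\pi(\beta(b))=V\pi(b)V^*$ for all $b\in B$. The \emph{Stacey crossed product} $B\times_\beta\mathbb N$ is the $C^*$-algebra generated by $i_B(B)\cup i_B(B)v$ for a universal Stacey-covariant representation $(i_B,v)$; for a Stacey-covariant representation $(\pi,V)$ in $D$, $\pi\times V:B\times_\beta\mathbb N\to D$ is the nondegenerate homomorphism with $(\pi\times V)\circ i_B=\pi$ and $\overline{\pi\times V}(v)=V$. Corollary. Suppose that $(A,\alpha,L)$ is an Exel system. Then there is an injective endomorphism $\beta$ of $(A\rtimes_{\alpha,L}\mathbb N)^{\hat\alpha}$ such that, for all $a,b\in A$ and $i\in\mathbb N=\{0,1,2,\dots\}$, $j(a)t^it^{*i}j(b)\in(A\rtimes_{\alpha,L}\mathbb N)^{\hat\alpha}$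 and $$\beta\big(j(a)t^it^{*i}j(b)\big)=j(\alpha(a))\,t^{i+1}t^{*(i+1)}\,j(\alpha(b)).$$ The endomorphism $\beta$ is extendible with $\overline\beta(1)=tt^*$ and has range $tt^*(A\rtimes_{\alpha,L}\mathbb N)^{\hat\alpha}tt^*$. The pair $(\operatorname{id},t)$, where $\operatorname{id}$ is the inclusion of $(A\rtimes_{\alpha,L}\mathbb N)^{\hat\alpha}$ in $A\rtimes_{\alpha,L}\mathbb N$, is a Stacey-covariant representation of $\big((A\rtimes_{\alpha,L}\mathbb N)^{\hat\alpha},\beta\big)$, and $\operatorname{id}\times t$ is an isomorphism of the Stacey crossed product $(A\rtimes_{\alpha,L}\mathbb N)^{\hat\alpha}\times_\beta\mathbb N$ onto the Exel crossed product $A\rtimes_{\alpha,L}\mathbb N$. -/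

import Mathlib

open scoped MultiplierAlgebra Topology
open Filter

universe u

noncomputable section

namespace CrossedProduct

section Multipliers

variable {A B : Type*} [NonUnitalCStarAlgebra A] [NonUnitalCStarAlgebra B]

/-- The strict topology on the multiplier algebra: `mᵢ → m` strictly if and only if
`mᵢ a → m a` and `a mᵢ → a m` in norm for every `a : A`. (For a double centralizer `m`,
`m.fst a` is `m a` and `m.snd a` is `a m`.) -/
abbrev strictTopology (A : Type*) [NonUnitalCStarAlgebra A] : TopologicalSpace 𝓜(ℂ, A) :=
  TopologicalSpace.induced (fun m (a : A) => (m.fst a, m.snd a)) inferInstance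

/-- `αbar` is a strictly continuous endomorphism of `M(A)` that extends `α`. -/
def IsStrictExtension (α : A →⋆ₙₐ[ℂ] A) (αbar : 𝓜(ℂ, A) →⋆ₙₐ[ℂ] 𝓜(ℂ, A)) : Prop :=
  @Continuous _ _ (strictTopology A) (strictTopology A) αbar ∧
    ∀ a : A, αbar (a : 𝓜(ℂ, A)) = (α a : 𝓜(ℂ, A))

/-- An endomorphism is extendible if it extends to a strictly continuous endomorphism of the
multiplier algebra (which need not be unital). -/
def IsExtendible (α : A →⋆ₙₐ[ℂ] A) : Prop :=
  ∃ αbar : 𝓜(ℂ, A) →⋆ₙₐ[ℂ] 𝓜(ℂ, A), IsStrictExtension α αbar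

/-- A homomorphism `π : A → B` is nondegenerate if `π(A)B` spans a dense subspace of `B`. -/
def IsNondegenerate (π : A →⋆ₙₐ[ℂ] B) : Prop :=
  Dense (Submodule.span ℂ {x : B | ∃ a b, x = π a * b} : Set B)

/-- A linear map between C⋆-algebras is positive if it maps positive elements, that is, elements
of the form `a* a`, to positive elements. -/
def IsPositive (L : A →ₗ[ℂ] B) : Prop :=
  ∀ a, ∃ b, L (star a * a) = star b * b

lemma mul_coe (m : 𝓜(ℂ, A)) (a : A) : m * (a : 𝓜(ℂ, A)) = (m.fst a : 𝓜(ℂ, A)) := by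
  have key : ∀ x y : A, m.fst (x * y) = m.fst x * y := by
    intro x y
    have h : ∀ z, z * m.fst (x * y) = z * (m.fst x * y) := fun z => by
      rw [← m.central, ← mul_assoc, m.central, mul_assoc]
    rw [← sub_eq_zero, ← CStarRing.star_mul_self_eq_zero_iff, mul_sub, h, sub_self]
  ext x
  · simp [key]
  · simp [m.central]

lemma coe_mul (m : 𝓜(ℂ, A)) (a : A) : (a : 𝓜(ℂ, A)) * m = (m.snd a : 𝓜(ℂ, A)) := by
  have key : ∀ x y : A, m.snd (x * y) = x * m.snd y := by
    intro x y
    have h : ∀ z, m.snd (x * y) * z = x * m.snd y * z := fun z => by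
      rw [m.central, mul_assoc, mul_assoc, m.central]
    rw [← sub_eq_zero, ← CStarRing.mul_star_self_eq_zero_iff, sub_mul, h, sub_self]
  ext x
  · simp [m.central]
  · simp [key]

lemma coe_mul_coe (a b : A) : (a : 𝓜(ℂ, A)) * (b : 𝓜(ℂ, A)) = ((a * b : A) : 𝓜(ℂ, A)) :=
  (map_mul (DoubleCentralizer.coeHom (𝕜 := ℂ) (A := A)) a b).symm

lemma star_coe (a : A) : star (a : 𝓜(ℂ, A)) = ((star a : A) : 𝓜(ℂ, A)) :=
  (map_star (DoubleCentralizer.coeHom (𝕜 := ℂ) (A := A)) a).symm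

lemma coe_injective : Function.Injective (fun a : A => (a : 𝓜(ℂ, A))) := by
  intro a b h
  have h' : ∀ x, a * x = b * x := fun x => by
    have := congrArg (fun m : 𝓜(ℂ, A) => m.fst x) h
    simpa using this
  rw [← sub_eq_zero, ← CStarRing.mul_star_self_eq_zero_iff, sub_mul, h', sub_self]

lemma fst_mul (m : 𝓜(ℂ, A)) (x y : A) : m.fst (x * y) = m.fst x * y := by
  apply coe_injective
  simp only [← mul_coe, ← coe_mul_coe, mul_assoc]

lemma snd_mul (m : 𝓜(ℂ, A)) (x y : A) : m.snd (x * y) = x * m.snd y := by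
  apply coe_injective
  simp only [← coe_mul, ← coe_mul_coe, mul_assoc]

lemma exists_approxUnit (A : Type*) [NonUnitalCStarAlgebra A] :
    ∃ l : Filter A, l.NeBot ∧ (∀ᶠ e in l, ‖e‖ ≤ 1 ∧ star e = e ∧
        ∀ z : A, ‖z - z * e‖ ≤ ‖z‖) ∧
      (∀ a, Tendsto (fun e => e * a) l (𝓝 a)) ∧ ∀ a, Tendsto (fun e => a * e) l (𝓝 a) := by
  let _ := CStarAlgebra.spectralOrder A
  let _ := CStarAlgebra.spectralOrderedRing A
  have h := CStarAlgebra.increasingApproximateUnit A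
  refine ⟨CStarAlgebra.approximateUnit A, h.neBot, ?_, h.tendsto_mul_right, h.tendsto_mul_left⟩
  filter_upwards [h.eventually_norm, h.eventually_nonneg, h.eventually_star_eq] with e h1 h2 h3
  refine ⟨h1, h3, fun z => ?_⟩
  have := CStarAlgebra.norm_sub_mul_self_le_of_inr (x := 0) (y := e) (star z) le_rfl h2 h1
    (norm_nonneg z) (by
      rw [Unitization.inr_zero, sub_zero, mul_one, CStarRing.norm_star_mul_self,
        Unitization.norm_inr, norm_star, sq])
  rw [← norm_star]
  simpa [h3] using this

/-- Strict completeness: a bounded strictly Cauchy family has a strict limit. -/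
lemma exists_strict_limit {ι : Type*} {l : Filter ι} [l.NeBot] {w : ι → B} {C : ℝ}
    (hw : ∀ᶠ e in l, ‖w e‖ ≤ C)
    (h1 : ∀ x, ∃ y, Tendsto (fun e => w e * x) l (𝓝 y))
    (h2 : ∀ x, ∃ y, Tendsto (fun e => x * w e) l (𝓝 y)) :
    ∃ m : 𝓜(ℂ, B), (∀ x, Tendsto (fun e => w e * x) l (𝓝 (m.fst x))) ∧
      ∀ x, Tendsto (fun e => x * w e) l (𝓝 (m.snd x)) := by
  choose f hf using h1
  choose g hg using h2
  have bf : ∀ x, ‖f x‖ ≤ C * ‖x‖ := fun x => le_of_tendsto (hf x).norm <| by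
    filter_upwards [hw] with e he
    exact (norm_mul_le _ _).trans (by gcongr)
  have bg : ∀ x, ‖g x‖ ≤ C * ‖x‖ := fun x => le_of_tendsto (hg x).norm <| by
    filter_upwards [hw] with e he
    exact (norm_mul_le _ _).trans (by rw [mul_comm]; gcongr)
  let F : B →ₗ[ℂ] B :=
    { toFun := f
      map_add' := fun x y => tendsto_nhds_unique (hf (x + y)) <| by
        simpa only [mul_add] using (hf x).add (hf y)
      map_smul' := fun c x => tendsto_nhds_unique (hf (c • x)) <| by
        simpa only [mul_smul_comm] using! (hf x).const_smul c }
  let G : B →ₗ[ℂ] B :=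
    { toFun := g
      map_add' := fun x y => tendsto_nhds_unique (hg (x + y)) <| by
        simpa only [add_mul] using (hg x).add (hg y)
      map_smul' := fun c x => tendsto_nhds_unique (hg (c • x)) <| by
        simpa only [smul_mul_assoc] using! (hg x).const_smul c }
  refine ⟨⟨(F.mkContinuous C bf, G.mkContinuous C bg), fun x y => ?_⟩, hf, hg⟩
  refine tendsto_nhds_unique ((hg x).mul_const y) ?_
  simp only [mul_assoc]
  exact (hf y).const_mul x

end Multipliers

/-- An Exel system `(A, α, L)`: an extendible endomorphism `α` and a transfer operator `L`, that
is, a positive linear map that extends to a positive linear map `Lbar` on `M(A)` such that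
`L(α(a) m) = a Lbar(m)` and `Lbar(1) = 1`. -/
structure ExelSystem (A : Type u) [NonUnitalCStarAlgebra A] where
  /-- the endomorphism -/
  α : A →⋆ₙₐ[ℂ] A
  /-- the transfer operator -/
  L : A →ₗ[ℂ] A
  extendible : IsExtendible α
  positive : IsPositive L
  transfer : ∃ Lbar : 𝓜(ℂ, A) →ₗ[ℂ] 𝓜(ℂ, A), IsPositive Lbar ∧
    (∀ a : A, Lbar (a : 𝓜(ℂ, A)) = (L a : 𝓜(ℂ, A))) ∧
    (∀ (a : A) (m : 𝓜(ℂ, A)), L (m.snd (α a)) = (Lbar m).snd a) ∧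
    Lbar 1 = 1

namespace ExelSystem

variable {A : Type u} [NonUnitalCStarAlgebra A] (S : ExelSystem A)

/-! ### The right-Hilbert bimodule `M_L` -/

lemma L_alpha_mul (a x : A) : S.L (S.α a * x) = a * S.L x := by
  obtain ⟨Lbar, -, h1, h2, -⟩ := S.transfer
  have := h2 a (x : 𝓜(ℂ, A))
  rw [h1] at this
  simpa using this

lemma star_L (x y : A) : star (S.L (star x * y)) = S.L (star y * x) := by
  have sa : ∀ z, star (S.L (star z * z)) = S.L (star z * z) := fun z => by
    obtain ⟨b, hb⟩ := S.positive z
    rw [hb, star_mul, star_star]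
  have h1 := sa (x + y)
  have h2 := sa (x + Complex.I • y)
  have hx := sa x
  have hy := sa y
  simp only [star_add, star_smul, add_mul, mul_add, map_add, smul_mul_assoc, mul_smul_comm,
    map_smul, hx, hy] at h1 h2
  have e1 : star (S.L (star x * y)) + star (S.L (star y * x)) =
      S.L (star x * y) + S.L (star y * x) := by
    have := sub_eq_zero.mpr h1
    rw [← sub_eq_zero, ← this]; abel
  have e2 : star (S.L (star x * y)) - star (S.L (star y * x)) =
      S.L (star y * x) - S.L (star x * y) := by
    simp only [Complex.star_def, Complex.conj_I, map_neg, neg_neg, neg_smul, smul_add,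
      smul_neg] at h2
    apply smul_right_injective A Complex.I_ne_zero
    have := sub_eq_zero.mpr h2
    simp only [smul_sub]
    rw [← sub_eq_zero, ← neg_eq_zero, ← this]
    abel
  have h4 : (2 : ℂ) • star (S.L (star x * y)) = (2 : ℂ) • S.L (star y * x) := by
    have := congrArg₂ (fun a b => a + b) e1 e2
    simp only [two_smul]
    rw [← sub_eq_zero] at this ⊢
    rw [← this]
    abel
  exact smul_right_injective A (two_ne_zero (α := ℂ)) h4

lemma L_mul_alpha (x y b : A) : S.L (star x * (y * S.α b)) = S.L (star x * y) * b := by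
  rw [← star_L, star_mul, mul_assoc, ← map_star S.α, L_alpha_mul, star_mul, star_star, star_L]

lemma norm_L_le_of_bound {x y : A} {c : ℝ} (hc : 0 ≤ c)
    (h : ∃ z, c • (star y * y) - star x * x = star z * z) :
    ‖S.L (star x * x)‖ ≤ c * ‖S.L (star y * y)‖ := by
  let _ := CStarAlgebra.spectralOrder A
  let _ := CStarAlgebra.spectralOrderedRing A
  obtain ⟨z, hz⟩ := h
  obtain ⟨w, hw⟩ := S.positive z
  obtain ⟨v, hv⟩ := S.positive x
  have h1 : S.L (star x * x) ≤ c • S.L (star y * y) := by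
    rw [← sub_nonneg]
    have : S.L (c • (star y * y)) = c • S.L (star y * y) := by
      simpa only [Complex.coe_smul] using map_smul S.L (c : ℂ) (star y * y)
    rw [← this, ← map_sub, hz, hw]
    exact star_mul_self_nonneg w
  have h0 : 0 ≤ S.L (star x * x) := hv ▸ star_mul_self_nonneg v
  refine (CStarAlgebra.norm_le_norm_of_nonneg_of_le h0 h1).trans ?_
  rw [norm_smul, Real.norm_of_nonneg hc]

lemma norm_L_left (a x : A) :
    ‖S.L (star (a * x) * (a * x))‖ ≤ ‖a‖ ^ 2 * ‖S.L (star x * x)‖ := by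
  apply S.norm_L_le_of_bound (sq_nonneg _)
  let _ := CStarAlgebra.spectralOrder A
  let _ := CStarAlgebra.spectralOrderedRing A
  have : star x * (star a * a) * x ≤ ‖star a * a‖ • (star x * x) :=
    CStarAlgebra.star_left_conjugate_le_norm_smul (IsSelfAdjoint.star_mul_self a)
  rw [CStarRing.norm_star_mul_self, ← sq, ← sub_nonneg] at this
  rw [star_mul, mul_assoc, ← mul_assoc (star a), ← mul_assoc]
  obtain ⟨z, hz⟩ := CStarAlgebra.nonneg_iff_eq_star_mul_self.mp this
  exact ⟨z, hz⟩

lemma norm_L_le (a : A) : ‖S.L (star a * a)‖ ≤ ‖a‖ ^ 2 := by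
  obtain ⟨Lbar, hpos, h1, -, h3⟩ := S.transfer
  let _ := CStarAlgebra.spectralOrder 𝓜(ℂ, A)
  let _ := CStarAlgebra.spectralOrderedRing 𝓜(ℂ, A)
  have hn : ∀ x : A, ‖(x : 𝓜(ℂ, A))‖ = ‖x‖ := fun x =>
    NonUnitalStarAlgHom.norm_map (DoubleCentralizer.coeHom (𝕜 := ℂ) (A := A)) coe_injective x
  have h4 : ((star a * a : A) : 𝓜(ℂ, A)) ≤ ‖(a : 𝓜(ℂ, A))‖ ^ 2 • (1 : 𝓜(ℂ, A)) := by
    rw [← coe_mul_coe, ← star_coe, sq, ← CStarRing.norm_star_mul_self,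
      ← Algebra.algebraMap_eq_smul_one]
    exact IsSelfAdjoint.le_algebraMap_norm_self (.star_mul_self _)
  rw [hn, ← sub_nonneg] at h4
  obtain ⟨z, hz⟩ := CStarAlgebra.nonneg_iff_eq_star_mul_self.mp h4
  obtain ⟨w, hw⟩ := hpos z
  obtain ⟨v, hv⟩ := S.positive a
  have h5 : (S.L (star a * a) : 𝓜(ℂ, A)) ≤ ‖a‖ ^ 2 • (1 : 𝓜(ℂ, A)) := by
    have e : Lbar (‖a‖ ^ 2 • (1 : 𝓜(ℂ, A))) = ‖a‖ ^ 2 • (1 : 𝓜(ℂ, A)) := by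
      have := map_smul Lbar ((‖a‖ ^ 2 : ℝ) : ℂ) 1
      rw [h3] at this
      simpa only [Complex.coe_smul] using this
    rw [← h1, ← sub_nonneg]
    nth_rw 1 [← e]
    rw [← map_sub, hz, hw]
    exact star_mul_self_nonneg w
  have h0 : 0 ≤ (S.L (star a * a) : 𝓜(ℂ, A)) := by
    rw [hv, ← coe_mul_coe, ← star_coe]; exact star_mul_self_nonneg _
  have h6 := CStarAlgebra.norm_le_norm_of_nonneg_of_le h0 h5
  rw [hn] at h6
  refine h6.trans ?_
  rw [norm_smul, norm_pow, norm_norm]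
  have : ‖(1 : 𝓜(ℂ, A))‖ ≤ 1 := by
    rcases subsingleton_or_nontrivial 𝓜(ℂ, A) with h | h
    · simp [Subsingleton.elim (1 : 𝓜(ℂ, A)) 0]
    · simp
  nlinarith [sq_nonneg ‖a‖]

/-- Cauchy–Schwarz. -/
lemma norm_L_sq_le (x y : A) :
    ‖S.L (star x * y)‖ ^ 2 ≤ ‖S.L (star x * x)‖ * ‖S.L (star y * y)‖ := by
  let _ := CStarAlgebra.spectralOrder A
  let _ := CStarAlgebra.spectralOrderedRing A
  set N := ‖S.L (star x * x)‖ with hN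
  set a := S.L (star x * y) with ha
  have hxx : IsSelfAdjoint (S.L (star x * x)) := S.star_L x x
  have main : ∀ c : ℝ, N < c → ‖a‖ ^ 2 ≤ c * ‖S.L (star y * y)‖ := by
    intro c hc
    have hc0 : 0 < c := (norm_nonneg _).trans_lt hc
    obtain ⟨b, hb⟩ := S.positive (x * S.α a - (c : ℂ) • y)
    have e : S.L (star (x * S.α a - (c : ℂ) • y) * (x * S.α a - (c : ℂ) • y)) =
        star a * S.L (star x * x) * a - (2 * c) • (star a * a)
          + (c * c) • S.L (star y * y) := by
      have h1 : S.L (star (x * S.α a) * (x * S.α a)) = star a * S.L (star x * x) * a := by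
        rw [L_mul_alpha, ← S.star_L x, L_mul_alpha, star_mul, S.star_L x x]
      have h2 : S.L (star (x * S.α a) * y) = star a * a := by
        rw [← star_L, L_mul_alpha, star_mul, ← S.star_L x y, star_star]
      have h3 : S.L (star y * (x * S.α a)) = star a * a := by
        rw [L_mul_alpha, ← star_L]
      rw [star_sub, sub_mul, mul_sub, mul_sub, star_smul]
      simp only [smul_mul_assoc, mul_smul_comm, map_sub, map_smul, h1, h2, h3]
      simp only [Complex.star_def, Complex.conj_ofReal, Complex.coe_smul, smul_smul, two_mul,
        add_smul]
      abel
    have h0 : 0 ≤ star a * S.L (star x * x) * a - (2 * c) • (star a * a)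
          + (c * c) • S.L (star y * y) := by
      rw [← e, hb]; exact star_mul_self_nonneg b
    have h1 : star a * S.L (star x * x) * a ≤ c • (star a * a) :=
      (CStarAlgebra.star_left_conjugate_le_norm_smul hxx).trans
        (smul_le_smul_of_nonneg_right hc.le (star_mul_self_nonneg a))
    have h2 : c • (star a * a) ≤ c • (c • S.L (star y * y)) := by
      rw [← sub_nonneg]
      refine h0.trans ?_
      rw [← sub_nonneg]
      have : c • (c • S.L (star y * y)) - c • (star a * a) -
          (star a * S.L (star x * x) * a - (2 * c) • (star a * a) + (c * c) • S.L (star y * y))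
          = c • (star a * a) - star a * S.L (star x * x) * a := by
        simp only [smul_smul, two_mul, add_smul]; abel
      rw [this]
      exact sub_nonneg.mpr h1
    have h3 := CStarAlgebra.norm_le_norm_of_nonneg_of_le
      (smul_nonneg hc0.le (star_mul_self_nonneg a)) h2
    rw [norm_smul, norm_smul, norm_smul, Real.norm_of_nonneg hc0.le,
      CStarRing.norm_star_mul_self, ← sq] at h3
    exact le_of_mul_le_mul_left h3 hc0
  refine le_of_forall_gt_imp_ge_of_dense ?_ |>.trans le_rfl
  intro d hd
  by_contra hlt
  push Not at hlt
  have hlim : Tendsto (fun c : ℝ => c * ‖S.L (star y * y)‖) (𝓝[>] N)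
      (𝓝 (N * ‖S.L (star y * y)‖)) :=
    ((continuous_id.mul continuous_const).tendsto N).mono_left nhdsWithin_le_nhds
  have := ge_of_tendsto hlim (Filter.eventually_of_mem self_mem_nhdsWithin main)
  linarith

end ExelSystem
namespace ExelSystem

variable {A : Type u} [NonUnitalCStarAlgebra A] (S : ExelSystem A)

/-- The vector space `A`, to be equipped with the seminorm `‖a‖ = ‖L(a* a)‖^(1/2)` of the
pre-inner product `⟨a, b⟩ = L(a* b)`. -/
def PreModule (_ : ExelSystem A) : Type u := A

instance : AddCommGroup S.PreModule := inferInstanceAs (AddCommGroup A)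

instance : Module ℂ S.PreModule := inferInstanceAs (Module ℂ A)

/-- The identity map `A → S.PreModule`. -/
def toPre : A →ₗ[ℂ] S.PreModule := LinearMap.id (M := A)

/-- The identity map `S.PreModule → A`. -/
def ofPre : S.PreModule →ₗ[ℂ] A := LinearMap.id (M := A)

instance : Norm S.PreModule where
  norm x := Real.sqrt ‖S.L (star (S.ofPre x) * S.ofPre x)‖

lemma pre_norm_def (x : S.PreModule) :
    ‖x‖ = Real.sqrt ‖S.L (star (S.ofPre x) * S.ofPre x)‖ := rfl

lemma norm_L_inner (x y : S.PreModule) :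
    ‖S.L (star (S.ofPre x) * S.ofPre y)‖ ≤ ‖x‖ * ‖y‖ := by
  rw [pre_norm_def, pre_norm_def, ← Real.sqrt_mul (norm_nonneg _)]
  exact Real.le_sqrt_of_sq_le (S.norm_L_sq_le _ _)

lemma preModule_core : SeminormedSpace.Core ℂ S.PreModule where
  norm_nonneg x := Real.sqrt_nonneg _
  norm_smul c x := by
    simp only [pre_norm_def, map_smul, star_smul, smul_mul_assoc, mul_smul_comm, norm_smul,
      norm_star]
    rw [← mul_assoc, Real.sqrt_mul (by positivity), Real.sqrt_mul_self (norm_nonneg c)]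
  norm_triangle x y := by
    have hx : 0 ≤ ‖x‖ := Real.sqrt_nonneg _
    have hy : 0 ≤ ‖y‖ := Real.sqrt_nonneg _
    rw [pre_norm_def]
    refine Real.sqrt_le_iff.mpr ⟨by positivity, ?_⟩
    have e : ∀ z : S.PreModule, ‖S.L (star (S.ofPre z) * S.ofPre z)‖ = ‖z‖ * ‖z‖ := fun z => by
      rw [pre_norm_def, Real.mul_self_sqrt (norm_nonneg _)]
    simp only [map_add, star_add, add_mul, mul_add]
    calc _ ≤ (‖S.L (star (S.ofPre x) * S.ofPre x)‖ + ‖S.L (star (S.ofPre y) * S.ofPre x)‖)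
            + (‖S.L (star (S.ofPre x) * S.ofPre y)‖ + ‖S.L (star (S.ofPre y) * S.ofPre y)‖) :=
          (norm_add_le _ _).trans (add_le_add (norm_add_le _ _) (norm_add_le _ _))
      _ ≤ _ := by
          rw [e, e]
          nlinarith [S.norm_L_inner x y, S.norm_L_inner y x]

instance : SeminormedAddCommGroup S.PreModule := .ofCore S.preModule_core

instance : NormedSpace ℂ S.PreModule where
  norm_smul_le c x := (S.preModule_core.norm_smul c x).le

/-- The Hilbert bimodule `M_L`: the Hausdorff completion of `A` for the seminorm
`‖a‖ = ‖L(a* a)‖^(1/2)`. -/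
abbrev ML : Type u := UniformSpace.Completion S.PreModule

/-- The canonical map `q : A → M_L`. -/
def q : A →ₗ[ℂ] S.ML :=
  (UniformSpace.Completion.toComplL (𝕜 := ℂ) (E := S.PreModule)).toLinearMap ∘ₗ S.toPre

lemma norm_q (a : A) : ‖S.q a‖ = Real.sqrt ‖S.L (star a * a)‖ :=
  UniformSpace.Completion.norm_coe (S.toPre a)

lemma norm_q_sq (a : A) : ‖S.q a‖ ^ 2 = ‖S.L (star a * a)‖ := by
  rw [norm_q, Real.sq_sqrt (norm_nonneg _)]

lemma norm_q_le (a : A) : ‖S.q a‖ ≤ ‖a‖ := by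
  rw [norm_q]
  exact Real.sqrt_le_iff.mpr ⟨norm_nonneg _, S.norm_L_le a⟩

lemma denseRange_q : DenseRange S.q :=
  UniformSpace.Completion.denseRange_coe (α := S.PreModule)

/-- The left action: `S.leftAction a` is the operator `φ(a)` on `M_L` with
`φ(a) q(b) = q(ab)`. -/
def leftAction (a : A) : S.ML →L[ℂ] S.ML :=
  (S.q ∘ₗ LinearMap.mulLeft ℂ a).extendOfNorm S.q

lemma leftAction_q (a b : A) : S.leftAction a (S.q b) = S.q (a * b) := by
  refine LinearMap.extendOfNorm_eq S.denseRange_q ⟨‖a‖, fun x => ?_⟩ b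
  change ‖S.q (a * x)‖ ≤ _
  refine abs_le_of_sq_le_sq' ?_ (by positivity) |>.2
  rw [mul_pow, norm_q_sq, norm_q_sq]
  exact S.norm_L_left a x

lemma norm_q_mul_alpha_le (a b : A) : ‖S.q (a * S.α b)‖ ≤ ‖S.q a‖ * ‖b‖ := by
  refine abs_le_of_sq_le_sq' ?_ (by positivity) |>.2
  rw [mul_pow, norm_q_sq, norm_q_sq, L_mul_alpha, ← star_L, L_mul_alpha, star_mul, star_L]
  calc _ ≤ ‖star b‖ * ‖S.L (star a * a)‖ * ‖b‖ :=
        (norm_mul_le _ _).trans (by gcongr; exact norm_mul_le _ _)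
    _ = _ := by rw [norm_star]; ring

/-- `b ↦ m · b` for `m = q(a)`; here `q(a) · b = q(a α(b))`. -/
def rightActionAux : A →ₗ[ℂ] A →L[ℂ] S.ML where
  toFun a := LinearMap.mkContinuous
    { toFun := fun b => S.q (a * S.α b)
      map_add' := fun _ _ => by rw [map_add, mul_add, map_add]
      map_smul' := fun _ _ => by rw [map_smul, mul_smul_comm, map_smul, RingHom.id_apply] }
    ‖S.q a‖ (S.norm_q_mul_alpha_le a)
  map_add' a b := by ext x; simp [add_mul]
  map_smul' c a := by ext x; simp [smul_mul_assoc]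

lemma rightActionAux_apply (a b : A) : S.rightActionAux a b = S.q (a * S.α b) := rfl

lemma norm_rightActionAux_le (a : A) : ‖S.rightActionAux a‖ ≤ 1 * ‖S.q a‖ := by
  rw [one_mul]
  exact ContinuousLinearMap.opNorm_le_bound _ (norm_nonneg _) (S.norm_q_mul_alpha_le a)

/-- The right action: `S.rightAction m b = m · b`. -/
def rightAction : S.ML →L[ℂ] A →L[ℂ] S.ML := S.rightActionAux.extendOfNorm S.q

lemma rightAction_q (a b : A) : S.rightAction (S.q a) b = S.q (a * S.α b) := by
  rw [rightAction, LinearMap.extendOfNorm_eq S.denseRange_q ⟨1, S.norm_rightActionAux_le⟩,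
    rightActionAux_apply]

/-- `n ↦ ⟨q(a), n⟩`. -/
def innerAux (a : A) : S.ML →L[ℂ] A :=
  (S.L ∘ₗ LinearMap.mulLeft ℂ (star a)).extendOfNorm S.q

lemma innerAux_bound (a x : A) :
    ‖(S.L ∘ₗ LinearMap.mulLeft ℂ (star a)) x‖ ≤ ‖S.q a‖ * ‖S.q x‖ := by
  have := S.norm_L_inner (S.toPre a) (S.toPre x)
  rw [norm_q, norm_q]
  exact this

lemma innerAux_q (a b : A) : S.innerAux a (S.q b) = S.L (star a * b) :=
  LinearMap.extendOfNorm_eq S.denseRange_q ⟨_, S.innerAux_bound a⟩ b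

lemma ext_q {F : Type*} [TopologicalSpace F] [AddCommMonoid F] [T2Space F] [Module ℂ F]
    {f g : S.ML →L[ℂ] F} (h : ∀ a, f (S.q a) = g (S.q a)) : f = g :=
  ContinuousLinearMap.coeFn_injective <|
    S.denseRange_q.equalizer f.continuous g.continuous (funext h)

/-- `innerAux` as a conjugate-linear map. -/
def innerAux' : A →ₗ⋆[ℂ] S.ML →L[ℂ] A where
  toFun := S.innerAux
  map_add' a b := S.ext_q fun x => by simp [innerAux_q, add_mul]
  map_smul' c a := S.ext_q fun x => by simp [innerAux_q, smul_mul_assoc]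

/-- The `A`-valued inner product of `M_L`, conjugate-linear in the first variable. -/
def inner : S.ML →L⋆[ℂ] S.ML →L[ℂ] A := S.innerAux'.extendOfNorm S.q

lemma inner_q_q (a b : A) : S.inner (S.q a) (S.q b) = S.L (star a * b) := by
  rw [inner, LinearMap.extendOfNorm_eq S.denseRange_q ⟨1, fun a => ?_⟩]
  · exact S.innerAux_q a b
  · rw [one_mul]
    exact LinearMap.opNorm_extendOfNorm_le S.denseRange_q (norm_nonneg _) (S.innerAux_bound a)

/-- The rank-one operator `Θ_{m,n} : p ↦ m · ⟨n, p⟩`. -/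
def rankOne (m n : S.ML) : S.ML →L[ℂ] S.ML := (S.rightAction m).comp (S.inner n)

/-- The algebra `K(M_L)` of compact operators: the closed span of the rank-one operators. -/
def compacts : Submodule ℂ (S.ML →L[ℂ] S.ML) :=
  (Submodule.span ℂ {k | ∃ m n, k = S.rankOne m n}).topologicalClosure

/-- The ideal `K_α`: the intersection of the closed ideal `A α(A) A` of `A` (the closed span of
the products) with `φ⁻¹(K(M_L))`. -/
def Kα : Set A :=
  {a | a ∈ (Submodule.span ℂ {x : A | ∃ b c d, x = b * S.α c * d}).topologicalClosure ∧
    S.leftAction a ∈ S.compacts}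

end ExelSystem

section Generated

variable {B : Type*} [NonUnitalCStarAlgebra B]

/-- The C⋆-algebra `B` is generated by the set `s`. -/
def IsGeneratedBy (s : Set B) : Prop :=
  (NonUnitalStarAlgebra.adjoin ℂ s).topologicalClosure = ⊤

lemma IsGeneratedBy.mem_of_right_ideal {s : Set B} (hs : IsGeneratedBy s) (D : Submodule ℂ B)
    (hD : IsClosed (D : Set B)) (h1 : ∀ x ∈ s, x ∈ D) (h2 : ∀ x ∈ s, star x ∈ D)
    (hmul : ∀ x ∈ D, ∀ y, x * y ∈ D) (x : B) : x ∈ D := by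
  have h : (NonUnitalStarAlgebra.adjoin ℂ s : Set B) ⊆ D := by
    intro y hy
    refine NonUnitalAlgebra.adjoin_induction (s := s ∪ star s) (p := fun y _ => y ∈ D)
      ?_ (fun _ _ _ _ => D.add_mem) D.zero_mem (fun a b _ _ ha _ => hmul a ha b)
      (fun c _ _ => D.smul_mem c) hy
    rintro z (hz | hz)
    · exact h1 z hz
    · simpa using h2 _ hz
  have hx : x ∈ (NonUnitalStarAlgebra.adjoin ℂ s).topologicalClosure := hs ▸ trivial
  exact closure_minimal h hD hx

lemma exists_tendsto_of_dense {ι : Type*} {l : Filter ι} [l.NeBot] (f : ι → B →ₗ[ℂ] B)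
    (hf : ∀ᶠ e in l, ∀ x, ‖f e x‖ ≤ ‖x‖) {s : Set B} (hs : Dense s)
    (h : ∀ x ∈ s, ∃ y, Tendsto (fun e => f e x) l (𝓝 y)) (x : B) :
    ∃ y, Tendsto (fun e => f e x) l (𝓝 y) := by
  rw [← cauchy_map_iff_exists_tendsto, Metric.cauchy_iff]
  refine ⟨inferInstance, fun ε hε => ?_⟩
  obtain ⟨x', hx', hd⟩ := Metric.mem_closure_iff.mp (hs x) (ε / 4) (by positivity)
  obtain ⟨y, hy⟩ := h x' hx'
  refine ⟨Metric.ball y (ε / 2), ?_, fun a ha b hb => ?_⟩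
  · rw [mem_map]
    filter_upwards [hf, Metric.tendsto_nhds.mp hy (ε / 4) (by positivity)] with e h1 h2
    have h3 := h1 (x - x')
    rw [map_sub, ← dist_eq_norm, ← dist_eq_norm] at h3
    exact (dist_triangle _ (f e x') _).trans_lt (by linarith)
  · exact (dist_triangle_right a b y).trans_lt (by
      rw [Metric.mem_ball] at ha hb; linarith)

end Generated

section Toeplitz

variable {A : Type u} [NonUnitalCStarAlgebra A]

/-- A Toeplitz-covariant representation of an Exel system in a C⋆-algebra `B`. -/
structure ToeplitzRep (S : ExelSystem A) (B : Type*) [NonUnitalCStarAlgebra B] where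
  /-- the representation of `A` -/
  π : A →⋆ₙₐ[ℂ] B
  nondegenerate : IsNondegenerate π
  /-- the multiplier -/
  V : 𝓜(ℂ, B)
  covariant : ∀ a, V * (π a : 𝓜(ℂ, B)) = (π (S.α a) : 𝓜(ℂ, B)) * V
  transfer : ∀ a, star V * (π a : 𝓜(ℂ, B)) * V = (π (S.L a) : 𝓜(ℂ, B))

namespace ToeplitzRep

variable {S : ExelSystem A} {B : Type*} [NonUnitalCStarAlgebra B] (ρ : ToeplitzRep S B)

/-- The element `π(a) V` of `B`. -/
def w (a : A) : B := ρ.V.snd (ρ.π a)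

lemma coe_w (a : A) : (ρ.w a : 𝓜(ℂ, B)) = (ρ.π a : 𝓜(ℂ, B)) * ρ.V := (coe_mul _ _).symm

lemma π_mul_w (a b : A) : ρ.π a * ρ.w b = ρ.w (a * b) := by
  rw [w, w, map_mul, snd_mul]

lemma w_mul_π (a b : A) : ρ.w a * ρ.π b = ρ.w (a * S.α b) := by
  apply coe_injective
  simp only [← coe_mul_coe, coe_w, mul_assoc, ρ.covariant, map_mul]

lemma star_w_mul_w (a b : A) : star (ρ.w a) * ρ.w b = ρ.π (S.L (star a * b)) := by
  apply coe_injective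
  simp only [← coe_mul_coe, coe_w, ← star_coe, star_mul, ← ρ.transfer, map_mul, map_star, mul_assoc]

lemma norm_w_le (a : A) : ‖ρ.w a‖ ≤ ‖S.q a‖ := by
  refine abs_le_of_sq_le_sq' ?_ (norm_nonneg _) |>.2
  rw [S.norm_q_sq, sq, ← CStarRing.norm_star_mul_self, star_w_mul_w]
  exact NonUnitalStarAlgHom.norm_apply_le _ _

end ToeplitzRep

/-- Formal ⋆-polynomials in the symbols `i(a)` and `w(a) = i(a)s`, for `a : A`. -/
inductive Poly (A : Type u) : Type u
  | i (a : A) : Poly A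
  | w (a : A) : Poly A
  | add (x y : Poly A) : Poly A
  | mul (x y : Poly A) : Poly A
  | smul (c : ℂ) (x : Poly A) : Poly A
  | star (x : Poly A) : Poly A

/-- Evaluation of a ⋆-polynomial. -/
def Poly.eval {B : Type*} [NonUnitalCStarAlgebra B] (f g : A → B) : Poly A → B
  | .i a => f a
  | .w a => g a
  | .add x y => x.eval f g + y.eval f g
  | .mul x y => x.eval f g * y.eval f g
  | .smul c x => c • x.eval f g
  | .star x => Star.star (x.eval f g)

namespace ExelSystem

variable (S : ExelSystem A)

/-- The C⋆-seminorms on the ⋆-polynomials that come from Toeplitz-covariant representations. They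
index a set of representations that contains, up to isomorphism of the C⋆-algebras generated, every
Toeplitz-covariant representation. -/
def RepIndex : Type u :=
  {p : Poly A → ℝ // ∃ (B : Type u) (_ : NonUnitalCStarAlgebra B) (ρ : ToeplitzRep S B),
    ∀ x, p x = ‖x.eval ρ.π ρ.w‖}

/-- The algebra of a representation with a given seminorm. -/
def RepAlg (p : S.RepIndex) : Type u := p.2.choose

instance (p : S.RepIndex) : NonUnitalCStarAlgebra (S.RepAlg p) := p.2.choose_spec.choose

/-- A representation with a given seminorm. -/
def rep (p : S.RepIndex) : ToeplitzRep S (S.RepAlg p) := p.2.choose_spec.choose_spec.choose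

lemma rep_spec (p : S.RepIndex) (x : Poly A) :
    p.1 x = ‖x.eval (S.rep p).π (S.rep p).w‖ :=
  p.2.choose_spec.choose_spec.choose_spec x

/-- The `ℓ^∞` direct sum of the representing algebras. -/
abbrev BigAlg : Type u := lp S.RepAlg ⊤

/-- The direct sum of the elements `π(a)`. -/
def bigI (a : A) : S.BigAlg :=
  ⟨fun p => (S.rep p).π a, memℓp_infty ⟨‖a‖, by
    rintro _ ⟨p, rfl⟩; exact NonUnitalStarAlgHom.norm_apply_le _ _⟩⟩

/-- The direct sum of the elements `π(a) V`. -/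
def bigW (a : A) : S.BigAlg :=
  ⟨fun p => (S.rep p).w a, memℓp_infty ⟨‖S.q a‖, by
    rintro _ ⟨p, rfl⟩; exact (S.rep p).norm_w_le a⟩⟩

/-- The C⋆-subalgebra generated by the `bigI a` and `bigW a`. -/
def toeplitzSubalgebra : NonUnitalStarSubalgebra ℂ S.BigAlg :=
  (NonUnitalStarAlgebra.adjoin ℂ (Set.range S.bigI ∪ Set.range S.bigW)).topologicalClosure

instance : IsClosed (S.toeplitzSubalgebra : Set S.BigAlg) :=
  NonUnitalStarSubalgebra.isClosed_topologicalClosure _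

/-- The Toeplitz crossed product `T(A, α, L)`. Its universal property is `toeplitz_universal`. -/
def ToeplitzAlg : Type u := S.toeplitzSubalgebra

instance : NonUnitalCStarAlgebra S.ToeplitzAlg :=
  inferInstanceAs (NonUnitalCStarAlgebra S.toeplitzSubalgebra)

/-- The inclusion of the Toeplitz crossed product in the direct sum. -/
def toBig : S.ToeplitzAlg →⋆ₙₐ[ℂ] S.BigAlg :=
  NonUnitalStarSubalgebraClass.subtype S.toeplitzSubalgebra

lemma toBig_injective : Function.Injective S.toBig := Subtype.val_injective

lemma norm_toBig (x : S.ToeplitzAlg) : ‖S.toBig x‖ = ‖x‖ := rfl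

lemma bigI_mem (a : A) : S.bigI a ∈ S.toeplitzSubalgebra :=
  NonUnitalStarSubalgebra.le_topologicalClosure _
    (NonUnitalStarAlgebra.subset_adjoin ℂ _ (.inl ⟨a, rfl⟩))

lemma bigW_mem (a : A) : S.bigW a ∈ S.toeplitzSubalgebra :=
  NonUnitalStarSubalgebra.le_topologicalClosure _
    (NonUnitalStarAlgebra.subset_adjoin ℂ _ (.inr ⟨a, rfl⟩))

/-- The canonical homomorphism `i : A → T(A, α, L)`. -/
def i : A →⋆ₙₐ[ℂ] S.ToeplitzAlg where
  toFun a := (⟨S.bigI a, S.bigI_mem a⟩ : S.toeplitzSubalgebra)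
  map_smul' c a := Subtype.ext <| lp.ext <| funext fun p => map_smul (S.rep p).π c a
  map_zero' := Subtype.ext <| lp.ext <| funext fun p => map_zero (S.rep p).π
  map_add' a b := Subtype.ext <| lp.ext <| funext fun p => map_add (S.rep p).π a b
  map_mul' a b := Subtype.ext <| lp.ext <| funext fun p => map_mul (S.rep p).π a b
  map_star' a := Subtype.ext <| lp.ext <| funext fun p => map_star (S.rep p).π a

/-- The elements `w(a)` of `T(A, α, L)`, equal to `i(a)s` by `coe_w` below. -/
def w (a : A) : S.ToeplitzAlg := (⟨S.bigW a, S.bigW_mem a⟩ : S.toeplitzSubalgebra)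

lemma toBig_i (a : A) (p : S.RepIndex) : S.toBig (S.i a) p = (S.rep p).π a := rfl

lemma toBig_w (a : A) (p : S.RepIndex) : S.toBig (S.w a) p = (S.rep p).w a := rfl

lemma ext_big {x y : S.ToeplitzAlg} (h : ∀ p, S.toBig x p = S.toBig y p) : x = y :=
  S.toBig_injective <| lp.ext <| funext h

lemma generated_i_w : IsGeneratedBy (Set.range S.i ∪ Set.range S.w) := by
  refine top_le_iff.mp fun x _ => ?_
  have hx : S.toBig x ∈ S.toeplitzSubalgebra := x.2
  change x ∈ closure _
  rw [(Isometry.isEmbedding (f := S.toBig) (AddMonoidHomClass.isometry_of_norm _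
    S.norm_toBig)).isInducing.closure_eq_preimage_closure_image]
  have e := NonUnitalStarAlgHom.map_adjoin (R := ℂ) S.toBig (Set.range S.i ∪ Set.range S.w)
  rw [Set.image_union, ← Set.range_comp, ← Set.range_comp] at e
  change S.toBig x ∈ closure (S.toBig '' _)
  have e' : S.toBig '' (NonUnitalStarAlgebra.adjoin ℂ (Set.range S.i ∪ Set.range S.w) :
      Set S.ToeplitzAlg) = (NonUnitalStarAlgebra.adjoin ℂ (Set.range S.bigI ∪ Set.range S.bigW) :
      Set S.BigAlg) := congrArg (fun K : NonUnitalStarSubalgebra ℂ S.BigAlg => (K : Set S.BigAlg)) e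
  rw [e']
  exact hx

lemma i_mul_w (a b : A) : S.i a * S.w b = S.w (a * b) :=
  S.ext_big fun p => (S.rep p).π_mul_w a b

lemma w_mul_i (a b : A) : S.w a * S.i b = S.w (a * S.α b) :=
  S.ext_big fun p => (S.rep p).w_mul_π a b

lemma star_w_mul_w (a b : A) : star (S.w a) * S.w b = S.i (S.L (star a * b)) :=
  S.ext_big fun p => (S.rep p).star_w_mul_w a b

/-- `w` as a linear map. -/
def wₗ : A →ₗ[ℂ] S.ToeplitzAlg where
  toFun := S.w
  map_add' a b := S.ext_big fun p => by
    simp [toBig_w, ToeplitzRep.w, map_add]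
  map_smul' c a := S.ext_big fun p => by
    simp [toBig_w, ToeplitzRep.w, map_smul]

lemma norm_w_le_q (a : A) : ‖S.w a‖ ≤ ‖S.q a‖ := by
  refine abs_le_of_sq_le_sq' ?_ (norm_nonneg _) |>.2
  rw [S.norm_q_sq, sq, ← CStarRing.norm_star_mul_self, star_w_mul_w]
  exact NonUnitalStarAlgHom.norm_apply_le _ _

lemma norm_w_le (a : A) : ‖S.w a‖ ≤ ‖a‖ := (S.norm_w_le_q a).trans (S.norm_q_le a)

lemma continuous_w : Continuous S.w :=
  (S.wₗ.mkContinuous 1 fun a => by rw [one_mul]; exact S.norm_w_le a).continuous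

lemma continuous_i : Continuous S.i :=
  AddMonoidHomClass.continuous_of_bound S.i 1 fun a => by
    rw [one_mul]; exact NonUnitalStarAlgHom.norm_apply_le _ _

lemma tendsto_i_mul {l : Filter A} (hb : ∀ᶠ e in l, ‖e‖ ≤ 1 ∧ star e = e ∧
      ∀ z : A, ‖z - z * e‖ ≤ ‖z‖)
    (hl : ∀ a, Tendsto (fun e => e * a) l (𝓝 a)) (hr : ∀ a, Tendsto (fun e => a * e) l (𝓝 a))
    (x : S.ToeplitzAlg) : Tendsto (fun e => S.i e * x) l (𝓝 x) := by
  let D : Submodule ℂ S.ToeplitzAlg :=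
    { carrier := {x | Tendsto (fun e => S.i e * x) l (𝓝 x)}
      add_mem' := fun {x y} hx hy => by
        simpa only [Set.mem_ofPred_eq, mul_add] using! Tendsto.add hx hy
      zero_mem' := by simp [tendsto_const_nhds]
      smul_mem' := fun c x hx => by
        simpa only [Set.mem_ofPred_eq, mul_smul_comm] using! Tendsto.const_smul hx c }
  refine S.generated_i_w.mem_of_right_ideal D ?_ ?_ ?_ ?_ x
  · rw [← isSeqClosed_iff_isClosed]
    intro f y hf hy
    change Tendsto _ _ _
    rw [Metric.tendsto_nhds]
    intro ε hε
    obtain ⟨n, hn⟩ := (Metric.tendsto_atTop.mp hy (ε / 3) (by positivity))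
    have h1 := Metric.tendsto_nhds.mp (hf n) (ε / 3) (by positivity)
    have h2 := hn n le_rfl
    filter_upwards [h1, hb] with e he hbe
    rw [dist_eq_norm] at he h2 ⊢
    have h3 : ‖S.i e * (y - f n)‖ ≤ ‖f n - y‖ := by
      rw [norm_sub_rev]
      refine (norm_mul_le _ _).trans ?_
      have := (NonUnitalStarAlgHom.norm_apply_le S.i e).trans hbe.1
      nlinarith [norm_nonneg (y - f n)]
    have : S.i e * y - y = S.i e * (y - f n) + (S.i e * f n - f n) + (f n - y) := by
      rw [mul_sub]; abel
    rw [this]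
    refine (norm_add₃_le).trans_lt ?_
    linarith
  · rintro _ (⟨a, rfl⟩ | ⟨a, rfl⟩)
    · change Tendsto _ _ _
      simp only [← map_mul]
      exact (S.continuous_i.tendsto a).comp (hl a)
    · change Tendsto _ _ _
      simp only [i_mul_w]
      exact (S.continuous_w.tendsto a).comp (hl a)
  · rintro _ (⟨a, rfl⟩ | ⟨a, rfl⟩)
    · change Tendsto _ _ _
      rw [← map_star]
      simp only [← map_mul]
      exact (S.continuous_i.tendsto _).comp (hl _)
    · change Tendsto _ _ _
      suffices h : Tendsto (fun e => S.w (a * S.α e)) l (𝓝 (S.w a)) by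
        refine ((continuous_star.tendsto _).comp h).congr' ?_
        filter_upwards [hb] with e he
        rw [Function.comp_apply, ← w_mul_i, star_mul, ← map_star, he.2.1]
      rw [tendsto_iff_norm_sub_tendsto_zero]
      have key : Tendsto (fun e => Real.sqrt ‖(S.L (star a * a) - S.L (star a * a) * e) -
          e * (S.L (star a * a) - S.L (star a * a) * e)‖) l (𝓝 0) := by
        have h1 : Tendsto (fun e => S.L (star a * a) - S.L (star a * a) * e) l (𝓝 0) := by
          simpa using (hr (S.L (star a * a))).const_sub (S.L (star a * a))
        have h2 : Tendsto (fun e => e * (S.L (star a * a) - S.L (star a * a) * e)) l (𝓝 0) := by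
          refine squeeze_zero_norm' ?_ (by simpa using h1.norm)
          filter_upwards [hb] with e he
          exact (norm_mul_le _ _).trans
            (mul_le_of_le_one_left (norm_nonneg _) he.1)
        simpa using ((h1.sub h2).norm).sqrt
      refine squeeze_zero' (.of_forall fun _ => norm_nonneg _) ?_ key
      filter_upwards [hb] with e he
      have : S.w (a * S.α e) - S.w a = S.w (a * S.α e - a) := (map_sub S.wₗ _ _).symm
      rw [this]
      refine (S.norm_w_le_q _).trans ?_
      rw [S.norm_q]
      apply le_of_eq
      congr 2
      rw [star_sub, sub_mul, mul_sub, mul_sub, map_sub, map_sub, map_sub, L_mul_alpha, L_mul_alpha,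
        ← S.star_L a, L_mul_alpha, star_mul, he.2.1, S.star_L a a, mul_sub, mul_assoc]
      abel
  · intro x hx y
    change Tendsto _ _ _
    simpa only [mul_assoc] using Tendsto.mul_const y hx

lemma i_nondegenerate : IsNondegenerate S.i := by
  obtain ⟨l, hne, hb, hl, hr⟩ := exists_approxUnit A
  intro x
  refine mem_closure_of_tendsto (S.tendsto_i_mul hb hl hr x) (.of_forall fun e => ?_)
  exact Submodule.subset_span ⟨e, x, rfl⟩

lemma exists_s : ∃ m : 𝓜(ℂ, S.ToeplitzAlg), (∀ a, m.snd (S.i a) = S.w a) ∧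
    (∀ a, m.fst (S.i a) = S.w (S.α a)) ∧ ∀ a, (star m).fst (S.w a) = S.i (S.L a) := by
  obtain ⟨l, hne, hb, hl, hr⟩ := exists_approxUnit A
  have hi := S.tendsto_i_mul hb hl hr
  have hi' : ∀ x, Tendsto (fun e => x * S.i e) l (𝓝 x) := fun x => by
    refine (star_star x ▸ (continuous_star.tendsto _).comp (hi (star x))).congr' ?_
    filter_upwards [hb] with e he
    rw [Function.comp_apply, star_mul, star_star, ← map_star, he.2.1]
  have hwb : ∀ᶠ e in l, ‖S.w e‖ ≤ 1 := by
    filter_upwards [hb] with e he using (S.norm_w_le e).trans he.1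
  obtain ⟨m, hm1, hm2⟩ := exists_strict_limit (l := l) (w := S.w) hwb
    (exists_tendsto_of_dense (fun e => LinearMap.mulLeft ℂ (S.w e))
      (by
        filter_upwards [hwb] with e he x
        exact (norm_mul_le _ _).trans (mul_le_of_le_one_left (norm_nonneg _) he))
      (s := {x | ∃ b y, x = S.i b * y})
      (fun x => mem_closure_of_tendsto (hi x) (.of_forall fun e => ⟨e, x, rfl⟩))
      (by
        rintro _ ⟨b, y, rfl⟩
        refine ⟨S.w (S.α b) * y, ?_⟩
        simp only [LinearMap.mulLeft_apply, ← mul_assoc, w_mul_i]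
        exact ((S.continuous_w.tendsto _).comp (hl _)).mul_const y))
    (exists_tendsto_of_dense (fun e => LinearMap.mulRight ℂ (S.w e))
      (by
        filter_upwards [hwb] with e he x
        exact (norm_mul_le _ _).trans (mul_le_of_le_one_right (norm_nonneg _) he))
      (s := {x | ∃ b y, x = y * S.i b})
      (fun x => mem_closure_of_tendsto (hi' x) (.of_forall fun e => ⟨e, x, rfl⟩))
      (by
        rintro _ ⟨b, y, rfl⟩
        refine ⟨y * S.w b, ?_⟩
        simp only [LinearMap.mulRight_apply, mul_assoc, i_mul_w]
        exact ((S.continuous_w.tendsto _).comp (hr _)).const_mul y))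
  have e1 : ∀ a, m.snd (S.i a) = S.w a := fun a => by
    refine tendsto_nhds_unique (hm2 _) ?_
    simp only [i_mul_w]
    exact (S.continuous_w.tendsto _).comp (hr _)
  have e2 : ∀ a, m.fst (S.i a) = S.w (S.α a) := fun a => by
    refine tendsto_nhds_unique (hm1 _) ?_
    simp only [w_mul_i]
    exact (S.continuous_w.tendsto _).comp (hl _)
  refine ⟨m, e1, e2, fun a => ?_⟩
  have h : ∀ b, S.i b * (star m).fst (S.w a) = S.i b * S.i (S.L a) := fun b => by
    rw [← (star m).central, DoubleCentralizer.star_snd, ← map_star S.i, e2, star_w_mul_w, map_star S.α,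
      star_star, L_alpha_mul, map_mul]
  refine tendsto_nhds_unique (hi _) ?_
  simp only [h]
  exact hi _

/-- The canonical multiplier `s` of `T(A, α, L)`, determined by `w(a) = i(a)s`. -/
def s : 𝓜(ℂ, S.ToeplitzAlg) := S.exists_s.choose

lemma s_snd (a : A) : S.s.snd (S.i a) = S.w a := S.exists_s.choose_spec.1 a

lemma coe_w (a : A) : (S.w a : 𝓜(ℂ, S.ToeplitzAlg)) = (S.i a : 𝓜(ℂ, S.ToeplitzAlg)) * S.s := by
  rw [coe_mul, s_snd]

/-- The universal Toeplitz-covariant representation `(i, s)`. -/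
def toeplitzRep : ToeplitzRep S S.ToeplitzAlg where
  π := S.i
  nondegenerate := S.i_nondegenerate
  V := S.s
  covariant a := by
    rw [mul_coe, coe_mul, s_snd]
    exact congrArg _ (S.exists_s.choose_spec.2.1 a)
  transfer a := by
    rw [mul_assoc, coe_mul, s_snd, mul_coe]
    exact congrArg _ (S.exists_s.choose_spec.2.2 a)

lemma toeplitzRep_w (a : A) : S.toeplitzRep.w a = S.w a := S.s_snd a

/-- The graph of the homomorphism `T(A, α, L) → B` induced by a representation in `B`. -/
def liftGraph {B : Type u} [NonUnitalCStarAlgebra B] (ρ : ToeplitzRep S B) :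
    NonUnitalStarSubalgebra ℂ (S.ToeplitzAlg × B) :=
  (NonUnitalStarAlgebra.adjoin ℂ (Set.range (fun a => (S.i a, ρ.π a)) ∪
    Set.range (fun a => (S.w a, ρ.w a)))).topologicalClosure

instance {B : Type u} [NonUnitalCStarAlgebra B] (ρ : ToeplitzRep S B) :
    IsClosed (S.liftGraph ρ : Set (S.ToeplitzAlg × B)) :=
  NonUnitalStarSubalgebra.isClosed_topologicalClosure _

lemma eval_toBig (x : Poly A) (p : S.RepIndex) :
    S.toBig (x.eval S.i S.w) p = x.eval (S.rep p).π (S.rep p).w := by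
  induction x with
  | i a => rfl
  | w a => rfl
  | add x y hx hy => simp only [Poly.eval, map_add, ← hx, ← hy]; rfl
  | mul x y hx hy => simp only [Poly.eval, map_mul, ← hx, ← hy]; rfl
  | smul c x hx => simp only [Poly.eval, map_smul, ← hx]; rfl
  | star x hx => simp only [Poly.eval, map_star, ← hx]; rfl

lemma norm_snd_le_of_mem_liftGraph {B : Type u} [NonUnitalCStarAlgebra B] (ρ : ToeplitzRep S B)
    (z : S.ToeplitzAlg × B) (hz : z ∈ S.liftGraph ρ) : ‖z.2‖ ≤ ‖z.1‖ := by
  have hc : IsClosed {z : S.ToeplitzAlg × B | ‖z.2‖ ≤ ‖z.1‖} :=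
    isClosed_le (by fun_prop) (by fun_prop)
  refine closure_minimal ?_ hc hz
  intro z hz
  have : ∃ x : Poly A, z = (x.eval S.i S.w, x.eval ρ.π ρ.w) := by
    refine NonUnitalStarAlgebra.adjoin_induction (R := ℂ)
      (p := fun z _ => ∃ x : Poly A, z = (x.eval S.i S.w, x.eval ρ.π ρ.w))
      ?_ ?_ ?_ ?_ ?_ ?_ hz
    · rintro _ (⟨a, rfl⟩ | ⟨a, rfl⟩)
      · exact ⟨.i a, rfl⟩
      · exact ⟨.w a, rfl⟩
    · rintro _ _ _ _ ⟨x, rfl⟩ ⟨y, rfl⟩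
      exact ⟨.add x y, rfl⟩
    · exact ⟨.i 0, by simp only [Poly.eval, map_zero]; rfl⟩
    · rintro _ _ _ _ ⟨x, rfl⟩ ⟨y, rfl⟩
      exact ⟨.mul x y, rfl⟩
    · rintro c _ _ ⟨x, rfl⟩
      exact ⟨.smul c x, rfl⟩
    · rintro _ _ ⟨x, rfl⟩
      exact ⟨.star x, rfl⟩
  obtain ⟨x, rfl⟩ := this
  let p : S.RepIndex := ⟨fun x => ‖x.eval ρ.π ρ.w‖, B, inferInstance, ρ, fun _ => rfl⟩
  have h1 : ‖x.eval ρ.π ρ.w‖ = ‖S.toBig (x.eval S.i S.w) p‖ := by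
    rw [eval_toBig, ← S.rep_spec p x]
  change ‖x.eval ρ.π ρ.w‖ ≤ ‖x.eval S.i S.w‖
  rw [h1, ← norm_toBig]
  exact lp.norm_apply_le_norm ENNReal.top_ne_zero _ _

/-- The projection of the graph. -/
def liftFst {B : Type u} [NonUnitalCStarAlgebra B] (ρ : ToeplitzRep S B) :
    S.liftGraph ρ →⋆ₙₐ[ℂ] S.ToeplitzAlg :=
  (NonUnitalStarAlgHom.fst ℂ S.ToeplitzAlg B).comp
    (NonUnitalStarSubalgebraClass.subtype (S.liftGraph ρ))

lemma liftFst_bijective {B : Type u} [NonUnitalCStarAlgebra B] (ρ : ToeplitzRep S B) :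
    Function.Bijective (S.liftFst ρ) := by
  have hiso : Isometry (S.liftFst ρ) := by
    refine AddMonoidHomClass.isometry_of_norm _ fun z => ?_
    exact (max_eq_left (S.norm_snd_le_of_mem_liftGraph ρ z.1 z.2)).symm
  refine ⟨hiso.injective, fun x => ?_⟩
  have hcl : IsClosed (NonUnitalStarAlgHom.range (S.liftFst ρ) : Set S.ToeplitzAlg) := by
    have := hiso.isClosedEmbedding.isClosed_range
    rwa [NonUnitalStarAlgHom.coe_range]
  have hle : (NonUnitalStarAlgebra.adjoin ℂ
      (Set.range S.i ∪ Set.range S.w)).topologicalClosure ≤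
      NonUnitalStarAlgHom.range (S.liftFst ρ) := by
    refine NonUnitalStarSubalgebra.topologicalClosure_minimal _ ?_ hcl
    refine NonUnitalStarAlgebra.adjoin_le ?_
    rintro _ (⟨a, rfl⟩ | ⟨a, rfl⟩)
    · exact ⟨⟨(S.i a, ρ.π a), NonUnitalStarSubalgebra.le_topologicalClosure _
        (NonUnitalStarAlgebra.subset_adjoin ℂ _ (.inl ⟨a, rfl⟩))⟩, rfl⟩
    · exact ⟨⟨(S.w a, ρ.w a), NonUnitalStarSubalgebra.le_topologicalClosure _
        (NonUnitalStarAlgebra.subset_adjoin ℂ _ (.inr ⟨a, rfl⟩))⟩, rfl⟩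
  rw [S.generated_i_w] at hle
  exact hle (x := x) trivial

/-- The homomorphism `T(A, α, L) → B` induced by a Toeplitz-covariant representation in `B`. -/
def lift {B : Type u} [NonUnitalCStarAlgebra B] (ρ : ToeplitzRep S B) :
    S.ToeplitzAlg →⋆ₙₐ[ℂ] B :=
  ((NonUnitalStarAlgHom.snd ℂ S.ToeplitzAlg B).comp
    (NonUnitalStarSubalgebraClass.subtype (S.liftGraph ρ))).comp
    ((StarAlgEquiv.ofBijective (S.liftFst ρ) (S.liftFst_bijective ρ)).symm :
      S.ToeplitzAlg →⋆ₙₐ[ℂ] S.liftGraph ρ)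

lemma lift_eq_of_mem {B : Type u} [NonUnitalCStarAlgebra B] (ρ : ToeplitzRep S B)
    {x : S.ToeplitzAlg} {y : B} (h : (x, y) ∈ S.liftGraph ρ) : S.lift ρ x = y := by
  have : (StarAlgEquiv.ofBijective (S.liftFst ρ) (S.liftFst_bijective ρ)).symm x = ⟨(x, y), h⟩ := by
    rw [StarAlgEquiv.symm_apply_eq]
    rfl
  change ((StarAlgEquiv.ofBijective (S.liftFst ρ) (S.liftFst_bijective ρ)).symm x).1.2 = y
  rw [this]

lemma lift_i {B : Type u} [NonUnitalCStarAlgebra B] (ρ : ToeplitzRep S B) (a : A) :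
    S.lift ρ (S.i a) = ρ.π a :=
  S.lift_eq_of_mem ρ (NonUnitalStarSubalgebra.le_topologicalClosure _
    (NonUnitalStarAlgebra.subset_adjoin ℂ _ (.inl ⟨a, rfl⟩)))

lemma lift_w {B : Type u} [NonUnitalCStarAlgebra B] (ρ : ToeplitzRep S B) (a : A) :
    S.lift ρ (S.w a) = ρ.w a :=
  S.lift_eq_of_mem ρ (NonUnitalStarSubalgebra.le_topologicalClosure _
    (NonUnitalStarAlgebra.subset_adjoin ℂ _ (.inr ⟨a, rfl⟩)))

lemma hom_ext {B : Type*} [NonUnitalCStarAlgebra B] {f g : S.ToeplitzAlg →⋆ₙₐ[ℂ] B}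
    (hi : ∀ a, f (S.i a) = g (S.i a)) (hw : ∀ a, f (S.w a) = g (S.w a)) : f = g := by
  have hf : ∀ f : S.ToeplitzAlg →⋆ₙₐ[ℂ] B, Continuous f := fun f =>
    AddMonoidHomClass.continuous_of_bound f 1 fun a => by
      rw [one_mul]; exact NonUnitalStarAlgHom.norm_apply_le _ _
  have hcl : IsClosed (NonUnitalStarAlgHom.equalizer f g : Set S.ToeplitzAlg) :=
    isClosed_eq (hf f) (hf g)
  have hle : (NonUnitalStarAlgebra.adjoin ℂ
      (Set.range S.i ∪ Set.range S.w)).topologicalClosure ≤ NonUnitalStarAlgHom.equalizer f g := by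
    refine NonUnitalStarSubalgebra.topologicalClosure_minimal _ ?_ hcl
    refine NonUnitalStarAlgebra.adjoin_le ?_
    rintro _ (⟨a, rfl⟩ | ⟨a, rfl⟩)
    · exact hi a
    · exact hw a
  rw [S.generated_i_w] at hle
  ext x
  exact hle (x := x) trivial

/-- The universal property of `(T(A, α, L), i, s)`: every Toeplitz-covariant representation
`(π, V)` in a C⋆-algebra `B` is `(Φ ∘ i, Φ(s))` for a unique homomorphism `Φ`, which is
nondegenerate; the second condition is stated as `Φ(s x) = V Φ(x)`. -/
theorem toeplitz_universal {B : Type u} [NonUnitalCStarAlgebra B] (ρ : ToeplitzRep S B) :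
    ∃! Φ : S.ToeplitzAlg →⋆ₙₐ[ℂ] B, IsNondegenerate Φ ∧ (∀ a, Φ (S.i a) = ρ.π a) ∧
      ∀ x, Φ (S.s.fst x) = ρ.V.fst (Φ x) := by
  have key : ∀ Φ : S.ToeplitzAlg →⋆ₙₐ[ℂ] B, (∀ a, Φ (S.i a) = ρ.π a) →
      (∀ a, Φ (S.w a) = ρ.w a) → ∀ x, Φ (S.s.fst x) = ρ.V.fst (Φ x) := by
    intro Φ h1 h2 x
    have hΦ : Continuous Φ := AddMonoidHomClass.continuous_of_bound Φ 1 fun a => by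
      rw [one_mul]; exact NonUnitalStarAlgHom.norm_apply_le _ _
    obtain ⟨l, hne, hb, hl, hr⟩ := exists_approxUnit A
    have hi := S.tendsto_i_mul hb hl hr x
    refine tendsto_nhds_unique
      ((hΦ.comp S.s.fst.continuous).tendsto _ |>.comp hi)
      (((ρ.V.fst.continuous.comp hΦ).tendsto _ |>.comp hi).congr fun e => ?_)
    simp only [Function.comp_apply, map_mul, fst_mul, h1]
    have h3 : S.s.fst (S.i e) = S.w (S.α e) := S.exists_s.choose_spec.2.1 e
    rw [h3, h2]
    congr 1
    apply coe_injective
    simp only [← mul_coe, ρ.covariant, ρ.coe_w]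
  have hw : ∀ Φ : S.ToeplitzAlg →⋆ₙₐ[ℂ] B, IsNondegenerate Φ → (∀ a, Φ (S.i a) = ρ.π a) →
      (∀ x, Φ (S.s.fst x) = ρ.V.fst (Φ x)) → ∀ a, Φ (S.w a) = ρ.w a := by
    intro Φ hn h1 h2 a
    have h3 : ∀ x, Φ (S.w a) * Φ x = ρ.w a * Φ x := fun x => by
      rw [← map_mul, ← s_snd, S.s.central, map_mul, h1, h2, ToeplitzRep.w, ρ.V.central]
    have h4 : ∀ y, Φ (S.w a) * y = ρ.w a * y := by
      intro y
      have hcl : IsClosed ((LinearMap.eqLocus (LinearMap.mulLeft ℂ (Φ (S.w a)))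
          (LinearMap.mulLeft ℂ (ρ.w a)) : Submodule ℂ B) : Set B) :=
        isClosed_eq (continuous_const.mul continuous_id) (continuous_const.mul continuous_id)
      refine closure_minimal (Submodule.span_le.mpr ?_) hcl (hn y)
      rintro _ ⟨x, b, rfl⟩
      change Φ (S.w a) * (Φ x * b) = ρ.w a * (Φ x * b)
      rw [← mul_assoc, h3, mul_assoc]
    rw [← sub_eq_zero, ← CStarRing.mul_star_self_eq_zero_iff, sub_mul, h4, sub_self]
  refine ⟨S.lift ρ, ⟨?_, S.lift_i ρ, key _ (S.lift_i ρ) (S.lift_w ρ)⟩, ?_⟩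
  · refine ρ.nondegenerate.mono (Submodule.span_mono ?_)
    rintro _ ⟨a, b, rfl⟩
    exact ⟨S.i a, b, by rw [lift_i]⟩
  · rintro Φ ⟨hn, h1, h2⟩
    exact S.hom_ext (fun a => by rw [h1, lift_i]) fun a => by rw [hw Φ hn h1 h2, lift_w]

end ExelSystem
end Toeplitz

section Quotients

variable {T : Type*} [NonUnitalCStarAlgebra T]

/-- Closed two-sided (hence self-adjoint) ideals of a C⋆-algebra. -/
structure ClosedIdeal (T : Type*) [NonUnitalCStarAlgebra T] extends Submodule ℂ T where
  mul_mem_left' : ∀ x y, y ∈ carrier → x * y ∈ carrier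
  mul_mem_right' : ∀ x y, x ∈ carrier → x * y ∈ carrier
  star_mem' : ∀ x, x ∈ carrier → star x ∈ carrier
  isClosed' : IsClosed carrier

namespace ClosedIdeal

/-- The closed ideal generated by a set: the intersection of all closed ideals containing it. -/
def generatedBy (X : Set T) : ClosedIdeal T where
  carrier := {x | ∀ I : ClosedIdeal T, X ⊆ I.carrier → x ∈ I.carrier}
  add_mem' hx hy I hI := I.add_mem (hx I hI) (hy I hI)
  zero_mem' I _ := I.zero_mem
  smul_mem' c _ hx I hI := I.smul_mem c (hx I hI)
  mul_mem_left' x y hy I hI := I.mul_mem_left' x y (hy I hI)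
  mul_mem_right' x y hx I hI := I.mul_mem_right' x y (hx I hI)
  star_mem' x hx I hI := I.star_mem' x (hx I hI)
  isClosed' := by
    simp only [Set.ofPred_forall]
    exact isClosed_iInter fun I => isClosed_iInter fun _ => I.isClosed'

lemma subset_generatedBy (X : Set T) : X ⊆ (generatedBy X).carrier := fun _ hx _ hI => hI hx

variable (I : ClosedIdeal T)

/-- A closed ideal as a C⋆-subalgebra. -/
def toSubalgebra : NonUnitalStarSubalgebra ℂ T where
  carrier := I.carrier
  add_mem' := I.add_mem'
  zero_mem' := I.zero_mem'
  smul_mem' := I.smul_mem'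
  mul_mem' := fun {x y} hx _ => I.mul_mem_right' x y hx
  star_mem' := fun {x} hx => I.star_mem' x hx

instance : IsClosed (I.toSubalgebra : Set T) := I.isClosed'

instance : IsClosed (I.toSubmodule : Set T) := I.isClosed'

/-- For `y` in the ideal there is `e` in the ideal with `y e` close to `y` and `‖1 - e‖ ≤ 1`. -/
lemma exists_approx {y : T} (hy : y ∈ I.carrier) {ε : ℝ} (hε : 0 < ε) :
    ∃ e ∈ I.carrier, star e = e ∧ (∀ z : T, ‖z - z * e‖ ≤ ‖z‖) ∧ ‖y - y * e‖ < ε := by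
  let _ := CStarAlgebra.spectralOrder I.toSubalgebra
  let _ := CStarAlgebra.spectralOrderedRing I.toSubalgebra
  let _ := CStarAlgebra.spectralOrder T
  let _ := CStarAlgebra.spectralOrderedRing T
  have h := CStarAlgebra.increasingApproximateUnit I.toSubalgebra
  have := h.neBot
  have h1 := Metric.tendsto_nhds.mp (h.tendsto_mul_left ⟨y, hy⟩) ε hε
  obtain ⟨e, h1, h2, h3, h4⟩ := (h1.and (h.eventually_norm.and
    (h.eventually_nonneg.and h.eventually_star_eq))).exists
  refine ⟨e.1, e.2, congrArg Subtype.val h4, fun z => ?_, ?_⟩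
  · have hpos : (0 : T) ≤ e.1 := by
      obtain ⟨b, hb⟩ := CStarAlgebra.nonneg_iff_eq_star_mul_self.mp h3
      rw [hb]
      exact star_mul_self_nonneg b.1
    have := CStarAlgebra.norm_sub_mul_self_le_of_inr (x := 0) (y := e.1) (star z) le_rfl hpos h2
      (norm_nonneg z) (by
        rw [Unitization.inr_zero, sub_zero, mul_one, CStarRing.norm_star_mul_self,
          Unitization.norm_inr, norm_star, sq])
    rw [← norm_star]
    have h5 : star e.1 = e.1 := congrArg Subtype.val h4
    simpa [h5] using this
  · rw [dist_eq_norm, norm_sub_rev] at h1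
    exact h1

/-- The quotient of a C⋆-algebra by a closed ideal, with the quotient norm. -/
def Quotient : Type _ := T ⧸ I.toSubmodule

instance : NormedAddCommGroup I.Quotient := inferInstanceAs (NormedAddCommGroup (T ⧸ I.toSubmodule))

instance : NormedSpace ℂ I.Quotient := inferInstanceAs (NormedSpace ℂ (T ⧸ I.toSubmodule))

instance : CompleteSpace I.Quotient := inferInstanceAs (CompleteSpace (T ⧸ I.toSubmodule))

/-- The quotient map as a linear map. -/
def mkₗ : T →L[ℂ] I.Quotient := I.toSubmodule.mkQL

lemma mkₗ_surjective : Function.Surjective I.mkₗ := I.toSubmodule.mkQ_surjective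

lemma mkₗ_eq_iff {x y : T} : I.mkₗ x = I.mkₗ y ↔ x - y ∈ I.carrier :=
  Submodule.Quotient.eq I.toSubmodule

lemma norm_mkₗ_le (x : T) : ‖I.mkₗ x‖ ≤ ‖x‖ := Submodule.Quotient.norm_mk_le I.toSubmodule x

lemma exists_norm_lt (x : I.Quotient) {ε : ℝ} (hε : 0 < ε) :
    ∃ m : T, I.mkₗ m = x ∧ ‖m‖ < ‖x‖ + ε :=
  Submodule.Quotient.norm_mk_lt (S := I.toSubmodule) x hε

instance : Mul I.Quotient where
  mul := Quotient.map₂ (· * ·) (by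
    intro a b hab c d hcd
    rw [← Quotient.eq_iff_equiv] at hab hcd ⊢
    have h1 : a - b ∈ I.carrier := (Submodule.Quotient.eq I.toSubmodule).mp hab
    have h2 : c - d ∈ I.carrier := (Submodule.Quotient.eq I.toSubmodule).mp hcd
    refine (Submodule.Quotient.eq I.toSubmodule).mpr ?_
    have : a * c - b * d = (a - b) * c + b * (c - d) := by rw [sub_mul, mul_sub]; abel
    rw [this]
    exact I.add_mem (I.mul_mem_right' _ _ h1) (I.mul_mem_left' _ _ h2))

instance : Star I.Quotient where
  star := Quotient.map star (by
    intro a b hab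
    rw [← Quotient.eq_iff_equiv] at hab ⊢
    have h1 : a - b ∈ I.carrier := (Submodule.Quotient.eq I.toSubmodule).mp hab
    refine (Submodule.Quotient.eq I.toSubmodule).mpr ?_
    rw [← star_sub]
    exact I.star_mem' _ h1)

lemma mkₗ_mul (x y : T) : I.mkₗ (x * y) = I.mkₗ x * I.mkₗ y := rfl

lemma mkₗ_star (x : T) : I.mkₗ (star x) = star (I.mkₗ x) := rfl

instance : NonUnitalNormedRing I.Quotient where
  left_distrib := by
    rintro a b c
    obtain ⟨a, rfl⟩ := I.mkₗ_surjective a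
    obtain ⟨b, rfl⟩ := I.mkₗ_surjective b
    obtain ⟨c, rfl⟩ := I.mkₗ_surjective c
    simp only [← map_add, ← mkₗ_mul, mul_add]
  right_distrib := by
    rintro a b c
    obtain ⟨a, rfl⟩ := I.mkₗ_surjective a
    obtain ⟨b, rfl⟩ := I.mkₗ_surjective b
    obtain ⟨c, rfl⟩ := I.mkₗ_surjective c
    simp only [← map_add, ← mkₗ_mul, add_mul]
  zero_mul := by
    rintro a
    obtain ⟨a, rfl⟩ := I.mkₗ_surjective a
    rw [← map_zero I.mkₗ, ← mkₗ_mul, zero_mul]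
  mul_zero := by
    rintro a
    obtain ⟨a, rfl⟩ := I.mkₗ_surjective a
    rw [← map_zero I.mkₗ, ← mkₗ_mul, mul_zero]
  mul_assoc := by
    rintro a b c
    obtain ⟨a, rfl⟩ := I.mkₗ_surjective a
    obtain ⟨b, rfl⟩ := I.mkₗ_surjective b
    obtain ⟨c, rfl⟩ := I.mkₗ_surjective c
    simp only [← mkₗ_mul, mul_assoc]
  dist_eq := NormedAddCommGroup.dist_eq
  norm_mul_le a b := by
    have h : ∀ ε > 0, ‖a * b‖ ≤ (‖a‖ + ε) * (‖b‖ + ε) := fun ε hε => by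
      obtain ⟨x, rfl, hx⟩ := I.exists_norm_lt a hε
      obtain ⟨y, rfl, hy⟩ := I.exists_norm_lt b hε
      rw [← mkₗ_mul]
      refine (I.norm_mkₗ_le _).trans ((norm_mul_le _ _).trans ?_)
      gcongr
    have hlim : Tendsto (fun ε : ℝ => (‖a‖ + ε) * (‖b‖ + ε)) (𝓝[>] 0) (𝓝 (‖a‖ * ‖b‖)) := by
      have : Continuous (fun ε : ℝ => (‖a‖ + ε) * (‖b‖ + ε)) := by fun_prop
      simpa using (this.tendsto 0).mono_left nhdsWithin_le_nhds
    exact ge_of_tendsto hlim (Filter.eventually_of_mem self_mem_nhdsWithin h)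

instance : StarRing I.Quotient where
  star_involutive := by
    rintro a
    obtain ⟨a, rfl⟩ := I.mkₗ_surjective a
    simp only [← mkₗ_star, star_star]
  star_mul := by
    rintro a b
    obtain ⟨a, rfl⟩ := I.mkₗ_surjective a
    obtain ⟨b, rfl⟩ := I.mkₗ_surjective b
    simp only [← mkₗ_mul, ← mkₗ_star, star_mul]
  star_add := by
    rintro a b
    obtain ⟨a, rfl⟩ := I.mkₗ_surjective a
    obtain ⟨b, rfl⟩ := I.mkₗ_surjective b
    simp only [← map_add, ← mkₗ_star, star_add]

lemma quotient_norm_mul_self_le (x : I.Quotient) : ‖x‖ * ‖x‖ ≤ ‖star x * x‖ := by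
  obtain ⟨x, rfl⟩ := I.mkₗ_surjective x
  refine le_of_forall_pos_le_add fun ε hε => ?_
  rw [← mkₗ_star, ← mkₗ_mul]
  obtain ⟨m, hm, hn⟩ := I.exists_norm_lt (I.mkₗ (star x * x)) (half_pos hε)
  have hy : star x * x - m ∈ I.carrier := I.mkₗ_eq_iff.mp hm.symm
  obtain ⟨e, he, hs, hz, hye⟩ := I.exists_approx hy (half_pos hε)
  have h1 : ‖I.mkₗ x‖ ≤ ‖x - x * e‖ := by
    have : I.mkₗ x = I.mkₗ (x - x * e) := by
      rw [mkₗ_eq_iff, sub_sub_cancel]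
      exact I.mul_mem_left' _ _ he
    rw [this]
    exact I.norm_mkₗ_le _
  have hz' : ∀ z : T, ‖z - e * z‖ ≤ ‖z‖ := fun z => by
    have := hz (star z)
    rw [← norm_star, star_sub, star_mul, star_star, hs, norm_star] at this
    exact this
  have h2 : ‖x - x * e‖ * ‖x - x * e‖ ≤ ‖m‖ + ‖(star x * x - m) - (star x * x - m) * e‖ := by
    rw [← CStarRing.norm_star_mul_self]
    have e1 : star (x - x * e) * (x - x * e) =
        ((m - m * e) - e * (m - m * e)) + (((star x * x - m) - (star x * x - m) * e) -
          e * ((star x * x - m) - (star x * x - m) * e)) := by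
      simp only [star_sub, star_mul, hs, sub_mul, mul_sub, mul_assoc]
      abel
    rw [e1]
    exact (norm_add_le _ _).trans (add_le_add ((hz' _).trans (hz _)) (hz' _))
  calc _ ≤ ‖x - x * e‖ * ‖x - x * e‖ := by gcongr
    _ ≤ _ := by linarith

instance : NonUnitalCStarAlgebra I.Quotient where
  norm_mul_self_le := I.quotient_norm_mul_self_le
  smul_assoc c a b := by
    obtain ⟨a, rfl⟩ := I.mkₗ_surjective a
    obtain ⟨b, rfl⟩ := I.mkₗ_surjective b
    simp only [smul_eq_mul, ← map_smul, ← mkₗ_mul, smul_mul_assoc]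
  smul_comm c a b := by
    obtain ⟨a, rfl⟩ := I.mkₗ_surjective a
    obtain ⟨b, rfl⟩ := I.mkₗ_surjective b
    simp only [smul_eq_mul, ← map_smul, ← mkₗ_mul, mul_smul_comm]
  star_smul c a := by
    obtain ⟨a, rfl⟩ := I.mkₗ_surjective a
    simp only [← map_smul, ← mkₗ_star, star_smul]

/-- The quotient homomorphism. -/
def quot : T →⋆ₙₐ[ℂ] I.Quotient where
  toFun := I.mkₗ
  map_smul' := map_smul I.mkₗ
  map_zero' := map_zero I.mkₗ
  map_add' := map_add I.mkₗ
  map_mul' := I.mkₗ_mul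
  map_star' := I.mkₗ_star

lemma quot_surjective : Function.Surjective I.quot := I.mkₗ_surjective

lemma quot_eq_zero_iff (x : T) : I.quot x = 0 ↔ x ∈ I.carrier :=
  Submodule.Quotient.mk_eq_zero I.toSubmodule

/-- The homomorphism on the quotient induced by a homomorphism vanishing on the ideal. -/
def lift {B : Type*} [NonUnitalCStarAlgebra B] (f : T →⋆ₙₐ[ℂ] B)
    (hf : ∀ x ∈ I.carrier, f x = 0) : I.Quotient →⋆ₙₐ[ℂ] B :=
  let g : I.Quotient →ₗ[ℂ] B := I.toSubmodule.liftQ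
    { toFun := f, map_add' := map_add f, map_smul' := map_smul f } hf
  { toFun := g
    map_smul' := map_smul g
    map_zero' := map_zero g
    map_add' := map_add g
    map_mul' := fun a b => by
      obtain ⟨a, rfl⟩ := I.mkₗ_surjective a
      obtain ⟨b, rfl⟩ := I.mkₗ_surjective b
      exact map_mul f a b
    map_star' := fun a => by
      obtain ⟨a, rfl⟩ := I.mkₗ_surjective a
      exact map_star f a }

lemma lift_quot {B : Type*} [NonUnitalCStarAlgebra B] (f : T →⋆ₙₐ[ℂ] B)
    (hf : ∀ x ∈ I.carrier, f x = 0) (x : T) : I.lift f hf (I.quot x) = f x := rfl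

lemma fst_mem (m : 𝓜(ℂ, T)) {x : T} (hx : x ∈ I.carrier) : m.fst x ∈ I.carrier := by
  obtain ⟨l, hne, -, hl, -⟩ := exists_approxUnit T
  refine I.isClosed'.mem_of_tendsto ((m.fst.continuous.tendsto _).comp (hl x))
    (.of_forall fun e => ?_)
  rw [Function.comp_apply, fst_mul]
  exact I.mul_mem_left' _ _ hx

lemma snd_mem (m : 𝓜(ℂ, T)) {x : T} (hx : x ∈ I.carrier) : m.snd x ∈ I.carrier := by
  obtain ⟨l, hne, -, -, hr⟩ := exists_approxUnit T
  refine I.isClosed'.mem_of_tendsto ((m.snd.continuous.tendsto _).comp (hr x))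
    (.of_forall fun e => ?_)
  rw [Function.comp_apply, snd_mul]
  exact I.mul_mem_right' _ _ hx

/-- The extension `M(T) → M(T/I)` of the quotient map: the image of `m` is the multiplier with
`m (x + I) = m x + I` and `(x + I) m = x m + I`. -/
def quotBar (m : 𝓜(ℂ, T)) : 𝓜(ℂ, I.Quotient) where
  fst := I.toSubmodule.liftQL (I.mkₗ.comp m.fst) fun x hx =>
    (I.quot_eq_zero_iff _).mpr (I.fst_mem m hx)
  snd := I.toSubmodule.liftQL (I.mkₗ.comp m.snd) fun x hx =>
    (I.quot_eq_zero_iff _).mpr (I.snd_mem m hx)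
  central a b := by
    obtain ⟨a, rfl⟩ := I.mkₗ_surjective a
    obtain ⟨b, rfl⟩ := I.mkₗ_surjective b
    exact congrArg I.mkₗ (m.central a b)

lemma quotBar_fst (m : 𝓜(ℂ, T)) (x : T) : (I.quotBar m).fst (I.quot x) = I.quot (m.fst x) := rfl

lemma quotBar_snd (m : 𝓜(ℂ, T)) (x : T) : (I.quotBar m).snd (I.quot x) = I.quot (m.snd x) := rfl

end ClosedIdeal

end Quotients

namespace ExelSystem

variable {A : Type u} [NonUnitalCStarAlgebra A] (S : ExelSystem A)

/-! ### The Exel crossed product -/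

/-- The linear map `ψ_s : M_L → T(A, α, L)` with `ψ_s(q(a)) = i(a)s`. -/
def ψ : S.ML →L[ℂ] S.ToeplitzAlg := S.wₗ.extendOfNorm S.q

lemma ψ_q (a : A) : S.ψ (S.q a) = S.w a :=
  LinearMap.extendOfNorm_eq S.denseRange_q
    ⟨1, fun a => by rw [one_mul]; exact S.norm_w_le_q a⟩ a

/-- The graph of the homomorphism `(ψ_s, i)^(1) : K(M_L) → T(A, α, L)` determined by
`(ψ_s, i)^(1)(Θ_{m,n}) = ψ_s(m) ψ_s(n)*`: since that homomorphism is continuous and `K(M_L)` is the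
closed span of the `Θ_{m,n}`, its graph is the closed span of the pairs
`(Θ_{m,n}, ψ_s(m) ψ_s(n)*)`. -/
def compactGraph : Submodule ℂ ((S.ML →L[ℂ] S.ML) × S.ToeplitzAlg) :=
  (Submodule.span ℂ {z | ∃ m n, z = (S.rankOne m n, S.ψ m * star (S.ψ n))}).topologicalClosure

/-- The elements `i(a) - (ψ_s, i)^(1)(φ(a))` of `T(A, α, L)`, for `a` in `K_α`. -/
def exelRelations : Set S.ToeplitzAlg :=
  {x | ∃ a ∈ S.Kα, ∃ y, (S.leftAction a, y) ∈ S.compactGraph ∧ x = S.i a - y}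

/-- The closed ideal of `T(A, α, L)` generated by these elements. -/
def exelIdeal : ClosedIdeal S.ToeplitzAlg := ClosedIdeal.generatedBy S.exelRelations

/-- The Exel crossed product `A ⋊_{α,L} ℕ`. -/
def ExelProduct : Type u := S.exelIdeal.Quotient

instance : NonUnitalCStarAlgebra S.ExelProduct :=
  inferInstanceAs (NonUnitalCStarAlgebra S.exelIdeal.Quotient)

/-- The quotient map `T(A, α, L) → A ⋊_{α,L} ℕ`. -/
def Q : S.ToeplitzAlg →⋆ₙₐ[ℂ] S.ExelProduct := S.exelIdeal.quot

/-- The canonical homomorphism `j : A → A ⋊_{α,L} ℕ`. -/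
def j : A →⋆ₙₐ[ℂ] S.ExelProduct := S.Q.comp S.i

/-- The canonical multiplier `t` of `A ⋊_{α,L} ℕ`, the image of `s`. -/
def t : 𝓜(ℂ, S.ExelProduct) := S.exelIdeal.quotBar S.s

/-! ### The dual action and its fixed-point algebra -/

/-- The Toeplitz-covariant representation `(i, zs)`. -/
def rotatedRep (z : Circle) : ToeplitzRep S S.ToeplitzAlg where
  π := S.i
  nondegenerate := S.i_nondegenerate
  V := (z : ℂ) • S.s
  covariant a := by
    rw [smul_mul_assoc, mul_smul_comm]
    exact congrArg _ (S.toeplitzRep.covariant a)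
  transfer a := by
    rw [star_smul, smul_mul_assoc, smul_mul_assoc, mul_smul_comm, smul_smul]
    have hz : star (z : ℂ) * (z : ℂ) = 1 := by
      rw [Complex.star_def, ← Complex.normSq_eq_conj_mul_self, Circle.normSq_coe, Complex.ofReal_one]
    rw [hz, one_smul]
    exact S.toeplitzRep.transfer a

/-- The dual action on `T(A, α, L)`. -/
def toeplitzGauge (z : Circle) : S.ToeplitzAlg →⋆ₙₐ[ℂ] S.ToeplitzAlg := S.lift (S.rotatedRep z)

lemma toeplitzGauge_i (z : Circle) (a : A) : S.toeplitzGauge z (S.i a) = S.i a := S.lift_i _ a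

lemma toeplitzGauge_w (z : Circle) (a : A) : S.toeplitzGauge z (S.w a) = (z : ℂ) • S.w a := by
  rw [toeplitzGauge, lift_w, ← s_snd]
  rfl

lemma continuous_toeplitzGauge (z : Circle) : Continuous (S.toeplitzGauge z) :=
  AddMonoidHomClass.continuous_of_bound (S.toeplitzGauge z) 1 fun a => by
    rw [one_mul]; exact NonUnitalStarAlgHom.norm_apply_le _ _

lemma toeplitzGauge_ψ (z : Circle) (m : S.ML) :
    S.toeplitzGauge z (S.ψ m) = (z : ℂ) • S.ψ m := by
  refine congrFun (S.denseRange_q.equalizer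
    ((S.continuous_toeplitzGauge z).comp S.ψ.continuous)
    (S.ψ.continuous.const_smul (z : ℂ)) (funext fun a => ?_)) m
  simp only [Function.comp_apply, Pi.smul_apply, ψ_q, toeplitzGauge_w]

lemma toeplitzGauge_compactGraph (z : Circle) (p : (S.ML →L[ℂ] S.ML) × S.ToeplitzAlg)
    (hp : p ∈ S.compactGraph) : S.toeplitzGauge z p.2 = p.2 := by
  let D : Submodule ℂ ((S.ML →L[ℂ] S.ML) × S.ToeplitzAlg) :=
    { carrier := {p | S.toeplitzGauge z p.2 = p.2}
      add_mem' := fun {p q} (hp : _ = _) (hq : _ = _) => by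
        change S.toeplitzGauge z (p.2 + q.2) = p.2 + q.2
        rw [map_add, hp, hq]
      zero_mem' := map_zero (S.toeplitzGauge z)
      smul_mem' := fun c p (hp : _ = _) => by
        change S.toeplitzGauge z (c • p.2) = c • p.2
        rw [map_smul, hp] }
  have hD : IsClosed (D : Set ((S.ML →L[ℂ] S.ML) × S.ToeplitzAlg)) :=
    isClosed_eq ((S.continuous_toeplitzGauge z).comp continuous_snd) continuous_snd
  refine closure_minimal (Submodule.span_le.mpr ?_) hD hp
  rintro _ ⟨m, n, rfl⟩
  change S.toeplitzGauge z (S.ψ m * star (S.ψ n)) = S.ψ m * star (S.ψ n)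
  have hz : star (z : ℂ) * (z : ℂ) = 1 := by
    rw [Complex.star_def, ← Complex.normSq_eq_conj_mul_self, Circle.normSq_coe, Complex.ofReal_one]
  rw [map_mul, map_star, toeplitzGauge_ψ, toeplitzGauge_ψ, star_smul, smul_mul_assoc,
    mul_smul_comm, smul_smul, mul_comm, hz, one_smul]

lemma toeplitzGauge_mem (z : Circle) (x : S.ToeplitzAlg) (hx : x ∈ S.exelIdeal.carrier) :
    S.toeplitzGauge z x ∈ S.exelIdeal.carrier := by
  let J : ClosedIdeal S.ToeplitzAlg :=
    { carrier := {x | S.toeplitzGauge z x ∈ S.exelIdeal.carrier}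
      add_mem' := fun {x y} hx hy => by
        change S.toeplitzGauge z (x + y) ∈ S.exelIdeal.carrier
        rw [map_add]; exact S.exelIdeal.add_mem hx hy
      zero_mem' := by
        change S.toeplitzGauge z 0 ∈ S.exelIdeal.carrier
        rw [map_zero]; exact S.exelIdeal.zero_mem
      smul_mem' := fun c x hx => by
        change S.toeplitzGauge z (c • x) ∈ S.exelIdeal.carrier
        rw [map_smul]; exact S.exelIdeal.smul_mem c hx
      mul_mem_left' := fun x y hy => by
        change S.toeplitzGauge z (x * y) ∈ S.exelIdeal.carrier
        rw [map_mul]; exact S.exelIdeal.mul_mem_left' _ _ hy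
      mul_mem_right' := fun x y hx => by
        change S.toeplitzGauge z (x * y) ∈ S.exelIdeal.carrier
        rw [map_mul]; exact S.exelIdeal.mul_mem_right' _ _ hx
      star_mem' := fun x hx => by
        change S.toeplitzGauge z (star x) ∈ S.exelIdeal.carrier
        rw [map_star]; exact S.exelIdeal.star_mem' _ hx
      isClosed' := S.exelIdeal.isClosed'.preimage (S.continuous_toeplitzGauge z) }
  refine hx J ?_
  rintro _ ⟨a, ha, y, hy, rfl⟩
  change S.toeplitzGauge z (S.i a - y) ∈ S.exelIdeal.carrier
  rw [map_sub, toeplitzGauge_i, S.toeplitzGauge_compactGraph z _ hy]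
  exact ClosedIdeal.subset_generatedBy _ ⟨a, ha, y, hy, rfl⟩

/-- The dual action `α̂` of the circle on `A ⋊_{α,L} ℕ`. -/
def dualAction (z : Circle) : S.ExelProduct →⋆ₙₐ[ℂ] S.ExelProduct :=
  S.exelIdeal.lift (S.Q.comp (S.toeplitzGauge z)) fun x hx =>
    (S.exelIdeal.quot_eq_zero_iff _).mpr (S.toeplitzGauge_mem z x hx)

lemma dualAction_j (z : Circle) (a : A) : S.dualAction z (S.j a) = S.j a :=
  congrArg S.Q (S.toeplitzGauge_i z a)

lemma dualAction_jt (z : Circle) (a : A) :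
    S.dualAction z (S.t.snd (S.j a)) = (z : ℂ) • S.t.snd (S.j a) := by
  have h : S.t.snd (S.j a) = S.Q (S.w a) := congrArg S.Q (S.s_snd a)
  rw [h, ← map_smul, ← toeplitzGauge_w]
  rfl

/-- The fixed-point algebra `(A ⋊_{α,L} ℕ)^α̂`. -/
def fixedPoints : NonUnitalStarSubalgebra ℂ S.ExelProduct where
  carrier := {x | ∀ z, S.dualAction z x = x}
  add_mem' hx hy z := by rw [map_add, hx z, hy z]
  zero_mem' z := map_zero _
  mul_mem' hx hy z := by rw [map_mul, hx z, hy z]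
  smul_mem' c x hx z := by rw [map_smul, hx z]
  star_mem' hx z := by rw [map_star, hx z]

instance : IsClosed (S.fixedPoints : Set S.ExelProduct) := by
  have : (S.fixedPoints : Set S.ExelProduct) = ⋂ z, {x | S.dualAction z x = x} := by
    ext x
    rw [Set.mem_iInter]
    rfl
  rw [this]
  refine isClosed_iInter fun z => isClosed_eq ?_ continuous_id
  exact AddMonoidHomClass.continuous_of_bound (S.dualAction z) 1 fun a => by
    rw [one_mul]; exact NonUnitalStarAlgHom.norm_apply_le _ _

/-- The inclusion of the fixed-point algebra. -/
def fixedIncl : S.fixedPoints →⋆ₙₐ[ℂ] S.ExelProduct :=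
  NonUnitalStarSubalgebraClass.subtype S.fixedPoints

end ExelSystem

/-! ### Stacey crossed products -/

/-- A Stacey-covariant representation of `(B, β)` in a C⋆-algebra `D`. -/
structure StaceyRep {B : Type*} [NonUnitalCStarAlgebra B] (β : B →⋆ₙₐ[ℂ] B) (D : Type*)
    [NonUnitalCStarAlgebra D] where
  /-- the representation of `B` -/
  π : B →⋆ₙₐ[ℂ] D
  nondegenerate : IsNondegenerate π
  /-- the isometry -/
  V : 𝓜(ℂ, D)
  isometry : star V * V = 1
  covariant : ∀ b, (π (β b) : 𝓜(ℂ, D)) = V * (π b : 𝓜(ℂ, D)) * star V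

/-- `(C, i_B, v)` is a Stacey crossed product of `(B, β)`: the C⋆-algebra `C` is generated by
`i_B(B) ∪ i_B(B)v`, and for every Stacey-covariant representation `(π, V)` in a C⋆-algebra `D`
there is a nondegenerate homomorphism `Φ = π × V` with `Φ ∘ i_B = π` and `Φ(v) = V`, where the
latter means `Φ(v x) = V Φ(x)` for all `x` in `C`. -/
def StaceyRep.IsCrossedProduct {B C : Type u} [NonUnitalCStarAlgebra B]
    [NonUnitalCStarAlgebra C] {β : B →⋆ₙₐ[ℂ] B} (ι : StaceyRep β C) : Prop :=
  IsGeneratedBy (Set.range ι.π ∪ Set.range fun b => ι.V.snd (ι.π b)) ∧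
    ∀ (D : Type u) [NonUnitalCStarAlgebra D] (ρ : StaceyRep β D),
      ∃ Φ : C →⋆ₙₐ[ℂ] D, IsNondegenerate Φ ∧ (∀ b, Φ (ι.π b) = ρ.π b) ∧
        ∀ x, Φ (ι.V.fst x) = ρ.V.fst (Φ x)

end CrossedProduct

end

open CrossedProduct

noncomputable section

namespace CrossedProduct

/-! ### Multipliers, nondegenerate homomorphisms and conjugation by isometries. -/

section Intertwining

variable {A B C : Type*} [NonUnitalCStarAlgebra A] [NonUnitalCStarAlgebra B]
  [NonUnitalCStarAlgebra C]

/-! Write E for the Exel crossed product and F for its fixed-point algebra. The multiplier t is an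
isometry: t* t j(a) = t* j(α(a)) t = j(L(α(a))) = j(a), because Lbar(1) = 1 (`star_t_mul_t`). The
endomorphism is β(x) = t x t*. It preserves F because the dual action scales t by z and t* by the
conjugate of z; it is injective because t* (t x t*) t = x; and its range is tt* F tt*. Since t
itself is not assumed to multiply F into F, the extension m ↦ t m t* to M(F) is computed in M(E),
into which M(F) embeds through the nondegenerate inclusion. Its strict continuity rests on
`exists_norm_βbar_fst`.

The isomorphism comes from showing that (E, id, t) already has the universal property of the Stacey
crossed product. Let (π, V) be a Stacey-covariant representation of (F, β). The strict limit of
β^i(j(e)) along an approximate unit of A is t^i t*^i, while π sends these elements to V^i π(j(e))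
V*^i. Hence the extension of π to M(F) maps t^i t*^i to V^i V*^i (`stacey_proj`). Applying it to the
identities β(j(a)) = j(α(a)) tt* and β(j(L(a))) = tt* j(a) tt* in F gives the two relations that
make (π ∘ j, V) Toeplitz-covariant (`stacey_covariant`, `stacey_transfer`).

The resulting homomorphism of the Toeplitz algebra vanishes on the Exel ideal
(`lift_eq_zero_of_mem`). On the range of (ψ_s, i)^(1) it equals π composed with the quotient map, as
both send i(a) s s* i(b)* to π(j(a) tt* j(b)*). In E the image of (ψ_s, i)^(1)(φ(a)) is j(a) for a
in K_α, so the relation is carried over from E by π, and no uniqueness theorem is needed.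

The homomorphism induced on E takes t to V. It extends π because the elements j(a) t^i t*^i j(b)
span a dense subspace of F (`dense_fixedSpan`). That density follows from the density in E of the
span of all j(a) t^i t*^k j(b) (`closure_monSpan`), by averaging the dual action over roots of
unity, which kills the terms with i ≠ k. -/

lemma continuous_hom (Φ : A →⋆ₙₐ[ℂ] B) : Continuous Φ :=
  AddMonoidHomClass.continuous_of_bound Φ 1 fun a => by
    rw [one_mul]; exact NonUnitalStarAlgHom.norm_apply_le _ _

/-- Centrality, (x m) y = x (m y), determines every product (x m) y from the left action, and a
C⋆-algebra has no nonzero annihilators. -/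
lemma multiplier_ext {m n : 𝓜(ℂ, A)} (h : ∀ x, m.fst x = n.fst x) : m = n := by
  have h' : ∀ x, m.snd x = n.snd x := fun x => by
    have : ∀ y, m.snd x * y = n.snd x * y := fun y => by rw [m.central, n.central, h]
    rw [← sub_eq_zero, ← CStarRing.mul_star_self_eq_zero_iff, sub_mul, this, sub_self]
  ext x
  exacts [h x, h' x]

/-- `Φ(Ux) = VΦ(x)` and `Φ(xU) = Φ(x)V` for all `x`; for nondegenerate `Φ` this says that the
extension of `Φ` to the multiplier algebras maps `U` to `V`. -/
structure Intertwines (Φ : A →⋆ₙₐ[ℂ] B) (U : 𝓜(ℂ, A)) (V : 𝓜(ℂ, B)) : Prop where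
  fst : ∀ x, Φ (U.fst x) = V.fst (Φ x)
  snd : ∀ x, Φ (U.snd x) = V.snd (Φ x)

namespace Intertwines

variable {Φ : A →⋆ₙₐ[ℂ] B} {U U' : 𝓜(ℂ, A)} {V V' : 𝓜(ℂ, B)}

protected lemma star (h : Intertwines Φ U V) : Intertwines Φ (star U) (star V) where
  fst x := by simp only [DoubleCentralizer.star_fst, map_star, h.snd]
  snd x := by simp only [DoubleCentralizer.star_snd, map_star, h.fst]

protected lemma mul (h : Intertwines Φ U V) (h' : Intertwines Φ U' V') :
    Intertwines Φ (U * U') (V * V') where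
  fst x := by
    simp only [DoubleCentralizer.mul_fst, mul_apply_eq_comp, h.fst, h'.fst]
  snd x := by
    simp only [DoubleCentralizer.mul_snd, mul_apply_eq_comp, h.snd, h'.snd]

protected lemma one (Φ : A →⋆ₙₐ[ℂ] B) : Intertwines Φ 1 1 := ⟨fun _ => rfl, fun _ => rfl⟩

protected lemma pow (h : Intertwines Φ U V) (n : ℕ) : Intertwines Φ (U ^ n) (V ^ n) := by
  induction n with
  | zero => simpa using Intertwines.one Φ
  | succ n ih => simpa only [pow_succ] using ih.mul h

protected lemma add (h : Intertwines Φ U V) (h' : Intertwines Φ U' V') :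
    Intertwines Φ (U + U') (V + V') where
  fst x := by
    simp only [DoubleCentralizer.add_fst, add_apply, map_add, h.fst, h'.fst]
  snd x := by
    simp only [DoubleCentralizer.add_snd, add_apply, map_add, h.snd, h'.snd]

protected lemma smul (h : Intertwines Φ U V) (c : ℂ) : Intertwines Φ (c • U) (c • V) where
  fst x := by
    simp only [DoubleCentralizer.smul_fst, smul_apply, map_smul, h.fst]
  snd x := by
    simp only [DoubleCentralizer.smul_snd, smul_apply, map_smul, h.snd]

protected lemma coe (Φ : A →⋆ₙₐ[ℂ] B) (a : A) :
    Intertwines Φ (a : 𝓜(ℂ, A)) (Φ a : 𝓜(ℂ, B)) where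
  fst x := by simp
  snd x := by simp

end Intertwines

/-- A multiplier acts continuously and commutes with right multiplication, so its values on π(A)
determine it on the closed span of π(A)B. This is how identities between multipliers are verified on
a smaller algebra. -/
lemma IsNondegenerate.eq_of_fst {π : A →⋆ₙₐ[ℂ] B} (hπ : IsNondegenerate π) {m n : 𝓜(ℂ, B)}
    (h : ∀ a, m.fst (π a) = n.fst (π a)) : m = n := by
  refine multiplier_ext fun x => ?_
  have hcl : IsClosed ((LinearMap.eqLocus m.fst.toLinearMap n.fst.toLinearMap :
      Submodule ℂ B) : Set B) := isClosed_eq m.fst.continuous n.fst.continuous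
  refine closure_minimal (Submodule.span_le.mpr ?_) hcl (hπ x)
  rintro _ ⟨a, b, rfl⟩
  change m.fst (π a * b) = n.fst (π a * b)
  rw [fst_mul, fst_mul, h]

lemma Intertwines.unique {π : A →⋆ₙₐ[ℂ] B} (hπ : IsNondegenerate π) {U : 𝓜(ℂ, A)}
    {V V' : 𝓜(ℂ, B)} (h : Intertwines π U V) (h' : Intertwines π U V') : V = V' :=
  hπ.eq_of_fst fun a => by rw [← h.fst, ← h'.fst]

lemma Intertwines.map_eq {π : A →⋆ₙₐ[ℂ] B} (hπ : IsNondegenerate π) {a : A}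
    {V : 𝓜(ℂ, B)} (h : Intertwines π (a : 𝓜(ℂ, A)) V) : (π a : 𝓜(ℂ, B)) = V :=
  (Intertwines.coe π a).unique hπ h

/-- For nondegenerate `Φ`, the left half of the intertwining relation implies the right half. -/
lemma IsNondegenerate.intertwines {Φ : A →⋆ₙₐ[ℂ] B} (hΦ : IsNondegenerate Φ) {U : 𝓜(ℂ, A)}
    {V : 𝓜(ℂ, B)} (h : ∀ x, Φ (U.fst x) = V.fst (Φ x)) : Intertwines Φ U V where
  fst := h
  snd x := by
    apply coe_injective
    refine hΦ.eq_of_fst fun y => ?_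
    simp only [DoubleCentralizer.coe_fst, ContinuousLinearMap.mul_apply', V.central, ← h,
      ← map_mul, U.central]

/-- It suffices to check an intertwining relation on the range of a nondegenerate homomorphism. -/
lemma IsNondegenerate.intertwines_of_comp {π : A →⋆ₙₐ[ℂ] B} (hπ : IsNondegenerate π)
    {Φ : B →⋆ₙₐ[ℂ] C} (hΦ : IsNondegenerate Φ) {U : 𝓜(ℂ, B)} {V : 𝓜(ℂ, C)}
    (h : ∀ a, Φ (U.fst (π a)) = V.fst (Φ (π a))) : Intertwines Φ U V := by
  refine hΦ.intertwines fun x => ?_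
  have hcl : IsClosed {x : B | Φ (U.fst x) = V.fst (Φ x)} :=
    isClosed_eq ((continuous_hom Φ).comp U.fst.continuous)
      (V.fst.continuous.comp (continuous_hom Φ))
  let D : Submodule ℂ B :=
    { carrier := {x : B | Φ (U.fst x) = V.fst (Φ x)}
      add_mem' := fun {x y} (hx : _ = _) (hy : _ = _) => by
        change Φ (U.fst (x + y)) = V.fst (Φ (x + y))
        rw [map_add, map_add, map_add, map_add, hx, hy]
      zero_mem' := by simp
      smul_mem' := fun c x (hx : _ = _) => by
        change Φ (U.fst (c • x)) = V.fst (Φ (c • x))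
        rw [map_smul, map_smul, map_smul, map_smul, hx] }
  refine closure_minimal (Submodule.span_le.mpr ?_ : _ ≤ D) hcl (hπ x)
  rintro _ ⟨a, b, rfl⟩
  change Φ (U.fst (π a * b)) = V.fst (Φ (π a * b))
  rw [fst_mul, map_mul, map_mul, fst_mul, h]

/-! ### Approximate units and extension of nondegenerate homomorphisms -/

/-- Eventual contractivity, uniform in the vector, lets convergence pass to limits of vectors by an
ε/3 argument. -/
lemma tendsto_of_dense_span {ι : Type*} {l : Filter ι} (f : ι → B →ₗ[ℂ] B)
    (hf : ∀ᶠ e in l, ∀ x, ‖f e x‖ ≤ ‖x‖) {s : Set B} (hs : Dense (Submodule.span ℂ s : Set B))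
    (h : ∀ x ∈ s, Tendsto (fun e => f e x) l (𝓝 x)) (x : B) :
    Tendsto (fun e => f e x) l (𝓝 x) := by
  let D : Submodule ℂ B :=
    { carrier := {x | Tendsto (fun e => f e x) l (𝓝 x)}
      add_mem' := fun {x y} hx hy => by
        simpa only [Set.mem_ofPred_eq, map_add] using! Tendsto.add hx hy
      zero_mem' := by simp [tendsto_const_nhds]
      smul_mem' := fun c x hx => by
        simpa only [Set.mem_ofPred_eq, map_smul] using! Tendsto.const_smul hx c }
  rw [Metric.tendsto_nhds]
  intro ε hε
  obtain ⟨y, hy, hd⟩ := Metric.mem_closure_iff.mp (hs x) (ε / 3) (by positivity)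
  have hy' : Tendsto (fun e => f e y) l (𝓝 y) := (Submodule.span_le.mpr h : _ ≤ D) hy
  filter_upwards [hf, Metric.tendsto_nhds.mp hy' (ε / 3) (by positivity)] with e h1 h2
  have h3 := h1 (x - y)
  rw [map_sub, ← dist_eq_norm, ← dist_eq_norm] at h3
  have h4 := dist_triangle4 (f e x) (f e y) y x
  rw [dist_comm y x] at h4
  linarith

lemma IsNondegenerate.tendsto_mul {π : A →⋆ₙₐ[ℂ] B} (hπ : IsNondegenerate π) {l : Filter A}
    (hb : ∀ᶠ e in l, ‖e‖ ≤ 1) (hl : ∀ a, Tendsto (fun e => e * a) l (𝓝 a)) (x : B) :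
    Tendsto (fun e => π e * x) l (𝓝 x) := by
  refine tendsto_of_dense_span (fun e => LinearMap.mulLeft ℂ (π e)) ?_ hπ ?_ x
  · filter_upwards [hb] with e he x
    exact (norm_mul_le _ _).trans (mul_le_of_le_one_left (norm_nonneg _)
      ((NonUnitalStarAlgHom.norm_apply_le π e).trans he))
  · rintro _ ⟨a, b, rfl⟩
    simp only [LinearMap.mulLeft_apply, ← mul_assoc, ← map_mul]
    exact (((continuous_hom π).tendsto a).comp (hl a)).mul_const b

lemma IsNondegenerate.tendsto_mul' {π : A →⋆ₙₐ[ℂ] B} (hπ : IsNondegenerate π) {l : Filter A}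
    (hb : ∀ᶠ e in l, ‖e‖ ≤ 1) (hs : ∀ᶠ e in l, star e = e)
    (hl : ∀ a, Tendsto (fun e => e * a) l (𝓝 a)) (x : B) :
    Tendsto (fun e => x * π e) l (𝓝 x) := by
  refine (star_star x ▸ (continuous_star.tendsto _).comp
    (hπ.tendsto_mul hb hl (star x))).congr' ?_
  filter_upwards [hs] with e he
  rw [Function.comp_apply, star_mul, star_star, ← map_star, he]

/-- Self-adjoint contractive approximate units exist. -/
lemma exists_selfAdjoint_approxUnit (A : Type*) [NonUnitalCStarAlgebra A] :
    ∃ l : Filter A, l.NeBot ∧ (∀ᶠ e in l, ‖e‖ ≤ 1) ∧ (∀ a, Tendsto (fun e => e * a) l (𝓝 a)) ∧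
      (∀ a, Tendsto (fun e => a * e) l (𝓝 a)) ∧ ∀ᶠ e in l, star e = e := by
  obtain ⟨l, hne, hb, hl, hr⟩ := exists_approxUnit A
  exact ⟨l, hne, hb.mono fun e he => he.1, hl, hr, hb.mono fun e he => he.2.1⟩

lemma exists_tendsto_of_dense_of_bound {ι : Type*} {l : Filter ι} [l.NeBot] (f : ι → B →ₗ[ℂ] B)
    {C : ℝ} (hf : ∀ᶠ e in l, ∀ x, ‖f e x‖ ≤ C * ‖x‖) {s : Set B} (hs : Dense s)
    (h : ∀ x ∈ s, ∃ y, Tendsto (fun e => f e x) l (𝓝 y)) (x : B) :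
    ∃ y, Tendsto (fun e => f e x) l (𝓝 y) := by
  -- The sign of C is not known; |C| + 1 is positive and at least C, so dividing by it makes the
  -- maps contractive.
  have hC : (0 : ℝ) < |C| + 1 := by positivity
  set c : ℂ := ((|C| + 1 : ℝ) : ℂ) with hc
  have hc0 : c ≠ 0 := by rw [hc, Complex.ofReal_ne_zero]; exact hC.ne'
  obtain ⟨y, hy⟩ := exists_tendsto_of_dense (l := l) (fun e => c⁻¹ • f e) (by
    filter_upwards [hf] with e he x
    rw [LinearMap.smul_apply, norm_smul, norm_inv, hc, Complex.norm_real,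
      Real.norm_of_nonneg hC.le, inv_mul_le_iff₀ hC]
    refine (he x).trans (mul_le_mul_of_nonneg_right ?_ (norm_nonneg x))
    linarith [le_abs_self C]) hs (fun x hx => by
      obtain ⟨y, hy⟩ := h x hx
      exact ⟨c⁻¹ • y, hy.const_smul _⟩) x
  refine ⟨c • y, (hy.const_smul c).congr fun e => ?_⟩
  rw [LinearMap.smul_apply, smul_smul, mul_inv_cancel₀ hc0, one_smul]

/-- M is the strict limit of π(m e) along an approximate unit e of A. The limit exists on the dense
sets π(A)B and Bπ(A), since π(m e) π(b) y tends to π(m b) y and y π(b) π(m e) = y π((b m) e) tends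
to y π(b m); boundedness does the rest. -/
lemma IsNondegenerate.exists_extend {π : A →⋆ₙₐ[ℂ] B} (hπ : IsNondegenerate π) (m : 𝓜(ℂ, A)) :
    ∃ M : 𝓜(ℂ, B), Intertwines π m M := by
  obtain ⟨l, hne, hb, hl, hr, hs⟩ := exists_selfAdjoint_approxUnit A
  have hw : ∀ᶠ e in l, ‖π (m.fst e)‖ ≤ ‖m.fst‖ := by
    filter_upwards [hb] with e he
    refine (NonUnitalStarAlgHom.norm_apply_le π _).trans ((m.fst.le_opNorm e).trans ?_)
    exact mul_le_of_le_one_right (norm_nonneg _) he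
  have h1 : ∀ a, Tendsto (fun e => π (m.fst e) * π a) l (𝓝 (π (m.fst a))) := fun a => by
    simp only [← map_mul, ← fst_mul]
    exact (((continuous_hom π).comp m.fst.continuous).tendsto a).comp (hl a)
  have h2 : ∀ a, Tendsto (fun e => π a * π (m.fst e)) l (𝓝 (π (m.snd a))) := fun a => by
    simp only [← map_mul, ← m.central]
    exact ((continuous_hom π).tendsto _).comp (hr _)
  obtain ⟨M, hM, -⟩ := exists_strict_limit (l := l) (w := fun e => π (m.fst e)) hw
    (exists_tendsto_of_dense_of_bound (fun e => LinearMap.mulLeft ℂ (π (m.fst e)))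
      (by
        filter_upwards [hw] with e he x
        exact (norm_mul_le _ _).trans (mul_le_mul_of_nonneg_right he (norm_nonneg x)))
      (s := {x | ∃ b y, x = π b * y})
      (fun x => mem_closure_of_tendsto (hπ.tendsto_mul hb hl x) (.of_forall fun e => ⟨e, x, rfl⟩))
      (by
        rintro _ ⟨b, y, rfl⟩
        refine ⟨π (m.fst b) * y, ?_⟩
        simp only [LinearMap.mulLeft_apply, ← mul_assoc]
        exact (h1 b).mul_const y))
    (exists_tendsto_of_dense_of_bound (fun e => LinearMap.mulRight ℂ (π (m.fst e)))
      (by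
        filter_upwards [hw] with e he x
        refine (norm_mul_le _ _).trans ?_
        rw [mul_comm]
        exact mul_le_mul_of_nonneg_right he (norm_nonneg x))
      (s := {x | ∃ b y, x = y * π b})
      (fun x => mem_closure_of_tendsto (hπ.tendsto_mul' hb hs hl x)
        (.of_forall fun e => ⟨e, x, rfl⟩))
      (by
        rintro _ ⟨b, y, rfl⟩
        refine ⟨y * π (m.snd b), ?_⟩
        simp only [LinearMap.mulRight_apply, mul_assoc]
        exact (h2 b).const_mul y))
  exact ⟨M, hπ.intertwines fun a => tendsto_nhds_unique (h1 a) (hM (π a))⟩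

/-- The extension of a nondegenerate homomorphism to the multiplier algebras. -/
def IsNondegenerate.extend {π : A →⋆ₙₐ[ℂ] B} (hπ : IsNondegenerate π) :
    𝓜(ℂ, A) →⋆ₙₐ[ℂ] 𝓜(ℂ, B) :=
  have h := fun m => (hπ.exists_extend m).choose_spec
  { toFun := fun m => (hπ.exists_extend m).choose
    map_smul' := fun c m => (h (c • m)).unique hπ ((h m).smul c)
    map_zero' := (h 0).unique hπ ⟨fun _ => map_zero π, fun _ => map_zero π⟩
    map_add' := fun m n => (h (m + n)).unique hπ ((h m).add (h n))
    map_mul' := fun m n => (h (m * n)).unique hπ ((h m).mul (h n))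
    map_star' := fun m => (h (star m)).unique hπ (h m).star }

lemma IsNondegenerate.intertwines_extend {π : A →⋆ₙₐ[ℂ] B} (hπ : IsNondegenerate π)
    (m : 𝓜(ℂ, A)) : Intertwines π m (hπ.extend m) :=
  (hπ.exists_extend m).choose_spec

lemma IsNondegenerate.extend_eq {π : A →⋆ₙₐ[ℂ] B} (hπ : IsNondegenerate π) {m : 𝓜(ℂ, A)}
    {M : 𝓜(ℂ, B)} (h : Intertwines π m M) : hπ.extend m = M :=
  (hπ.intertwines_extend m).unique hπ h

lemma IsNondegenerate.extend_injective {π : A →⋆ₙₐ[ℂ] B} (hπ : IsNondegenerate π)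
    (hinj : Function.Injective π) : Function.Injective hπ.extend := fun m n h =>
  multiplier_ext fun x => hinj <| by
    rw [(hπ.intertwines_extend m).fst, (hπ.intertwines_extend n).fst, h]

/-- If `w` tends strictly to `U` and `π ∘ w` tends strictly to `V`, then `π` maps `U` to `V`. -/
lemma intertwines_of_tendsto {π : A →⋆ₙₐ[ℂ] B} (hπ : IsNondegenerate π) {ι : Type*}
    {l : Filter ι} [l.NeBot] {w : ι → A} {U : 𝓜(ℂ, A)} {V : 𝓜(ℂ, B)}
    (hU : ∀ x, Tendsto (fun e => w e * x) l (𝓝 (U.fst x)))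
    (hV : ∀ y, Tendsto (fun e => π (w e) * y) l (𝓝 (V.fst y))) : Intertwines π U V :=
  hπ.intertwines fun x => by
    refine tendsto_nhds_unique (((continuous_hom π).tendsto _).comp (hU x)) ?_
    simpa only [Function.comp_def, map_mul] using hV (π x)

/-- Conjugation `x ↦ V x V*` by a multiplier. -/
def conj (V : 𝓜(ℂ, A)) (x : A) : A := V.fst ((star V).snd x)

lemma coe_conj (V : 𝓜(ℂ, A)) (x : A) :
    ((conj V x : A) : 𝓜(ℂ, A)) = V * (x : 𝓜(ℂ, A)) * star V := by
  rw [conj, ← mul_coe, ← coe_mul, mul_assoc]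

/-- Conjugation by an isometry, as a homomorphism. -/
def conjHom (V : 𝓜(ℂ, A)) (hV : star V * V = 1) : A →⋆ₙₐ[ℂ] A where
  toFun := conj V
  map_smul' c x := by simp [conj]
  map_zero' := by simp [conj]
  map_add' x y := by simp [conj]
  map_mul' x y := by
    apply coe_injective
    simp only [← coe_mul_coe, coe_conj, mul_assoc]
    rw [← mul_assoc (star V) V, hV, one_mul]
  map_star' x := by
    apply coe_injective
    simp only [← star_coe, coe_conj, star_mul, star_star, mul_assoc]

/-- This left inverse makes conjugation by an isometry injective, hence norm-preserving. -/
lemma conj_star_conj (V : 𝓜(ℂ, A)) (hV : star V * V = 1) (x : A) :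
    conj (star V) (conj V x) = x := by
  apply coe_injective
  simp only [coe_conj, star_star, mul_assoc, hV, mul_one]
  rw [← mul_assoc, hV, one_mul]

lemma norm_conj (V : 𝓜(ℂ, A)) (hV : star V * V = 1) (x : A) : ‖conj V x‖ = ‖x‖ :=
  NonUnitalStarAlgHom.norm_map (conjHom V hV) (Function.LeftInverse.injective (conj_star_conj V hV)) x

end Intertwining

/-! ### Induction and extensionality from generators of a C⋆-algebra. -/

section Generated

variable {B C : Type*} [NonUnitalCStarAlgebra B] [NonUnitalCStarAlgebra C]

/-- Compared with `mem_of_right_ideal`, D has only to be stable under products of its own elements.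
-/
lemma IsGeneratedBy.induction {s : Set B} (hs : IsGeneratedBy s) (D : Submodule ℂ B)
    (hD : IsClosed (D : Set B)) (h1 : ∀ x ∈ s, x ∈ D) (h2 : ∀ x ∈ s, star x ∈ D)
    (hmul : ∀ x ∈ D, ∀ y ∈ D, x * y ∈ D) (x : B) : x ∈ D := by
  have h : (NonUnitalStarAlgebra.adjoin ℂ s : Set B) ⊆ D := by
    intro y hy
    refine NonUnitalAlgebra.adjoin_induction (s := s ∪ star s) (p := fun y _ => y ∈ D)
      ?_ (fun _ _ _ _ => D.add_mem) D.zero_mem (fun a b _ _ ha hb => hmul a ha b hb)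
      (fun c _ _ => D.smul_mem c) hy
    rintro z (hz | hz)
    · exact h1 z hz
    · simpa using h2 _ hz
  have hx : x ∈ (NonUnitalStarAlgebra.adjoin ℂ s).topologicalClosure := hs ▸ trivial
  exact closure_minimal h hD hx

lemma IsGeneratedBy.hom_ext {s : Set B} (hs : IsGeneratedBy s) {f g : B →⋆ₙₐ[ℂ] C}
    (h : ∀ x ∈ s, f x = g x) : f = g := by
  have hle : (NonUnitalStarAlgebra.adjoin ℂ s).topologicalClosure ≤
      NonUnitalStarAlgHom.equalizer f g :=
    NonUnitalStarSubalgebra.topologicalClosure_minimal _ (NonUnitalStarAlgebra.adjoin_le h)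
      (isClosed_eq (continuous_hom f) (continuous_hom g))
  rw [hs] at hle
  ext x
  exact hle (x := x) trivial

lemma IsGeneratedBy.map {s : Set B} (hs : IsGeneratedBy s) {f : B →⋆ₙₐ[ℂ] C}
    (hf : Function.Surjective f) : IsGeneratedBy (f '' s) := by
  refine top_le_iff.mp fun y _ => ?_
  obtain ⟨x, rfl⟩ := hf y
  have hle : (NonUnitalStarAlgebra.adjoin ℂ s).topologicalClosure ≤
      ((NonUnitalStarAlgebra.adjoin ℂ (f '' s)).topologicalClosure).comap f :=
    NonUnitalStarSubalgebra.topologicalClosure_minimal _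
      (NonUnitalStarAlgebra.adjoin_le fun x hx =>
        NonUnitalStarSubalgebra.le_topologicalClosure _
          (NonUnitalStarAlgebra.subset_adjoin ℂ _ ⟨x, hx, rfl⟩))
      ((NonUnitalStarSubalgebra.isClosed_topologicalClosure _).preimage (continuous_hom f))
  rw [hs] at hle
  exact hle (x := x) trivial

lemma IsGeneratedBy.mono {s s' : Set B} (hs : IsGeneratedBy s) (h : s ⊆ s') :
    IsGeneratedBy s' := by
  refine top_le_iff.mp (hs.ge.trans ?_)
  exact NonUnitalStarSubalgebra.topologicalClosure_mono (NonUnitalStarAlgebra.adjoin_mono h)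

end Generated

/-! ### Composites and factors of nondegenerate homomorphisms. -/

section Nondegenerate

variable {A B C : Type*} [NonUnitalCStarAlgebra A] [NonUnitalCStarAlgebra B]
  [NonUnitalCStarAlgebra C]

lemma IsNondegenerate.of_comp {π : A →⋆ₙₐ[ℂ] B} {Φ : B →⋆ₙₐ[ℂ] C}
    (h : IsNondegenerate (Φ.comp π)) : IsNondegenerate Φ := by
  refine h.mono (Submodule.span_mono ?_)
  rintro _ ⟨a, c, rfl⟩
  exact ⟨π a, c, rfl⟩

/-- For an approximate unit e of A, Φ(b) c is the limit of Φ(π(e) b) c = Φ(π(e)) (Φ(b) c). -/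
lemma IsNondegenerate.comp {π : A →⋆ₙₐ[ℂ] B} {Φ : B →⋆ₙₐ[ℂ] C} (hΦ : IsNondegenerate Φ)
    (hπ : IsNondegenerate π) : IsNondegenerate (Φ.comp π) := by
  set D := Submodule.span ℂ {x : C | ∃ a c, x = Φ.comp π a * c}
  have key : ∀ b c, Φ b * c ∈ D.topologicalClosure := fun b c => by
    obtain ⟨l, hne, hb, hl, hr, hs⟩ := exists_selfAdjoint_approxUnit A
    refine D.isClosed_topologicalClosure.mem_of_tendsto
      (((continuous_hom Φ).tendsto _).comp (hπ.tendsto_mul hb hl b) |>.mul_const c)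
      (.of_forall fun e => ?_)
    rw [Function.comp_apply, map_mul, mul_assoc]
    exact Submodule.le_topologicalClosure _ (Submodule.subset_span ⟨e, _, rfl⟩)
  intro x
  refine closure_minimal (Submodule.span_le.mpr ?_) D.isClosed_topologicalClosure (hΦ x)
  rintro _ ⟨b, c, rfl⟩
  exact key b c

lemma IsNondegenerate.of_surjective {Φ : B →⋆ₙₐ[ℂ] C} (hΦ : Function.Surjective Φ) :
    IsNondegenerate Φ := by
  obtain ⟨l, hne, -, hl, -⟩ := exists_approxUnit C
  intro x
  refine mem_closure_of_tendsto (hl x) (.of_forall fun e => ?_)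
  obtain ⟨b, rfl⟩ := hΦ e
  exact Submodule.subset_span ⟨b, x, rfl⟩

end Nondegenerate

namespace ExelSystem

variable {A : Type u} [NonUnitalCStarAlgebra A] (S : ExelSystem A)

/-! ### Relations in the Exel crossed product -/

lemma Q_surjective : Function.Surjective S.Q := S.exelIdeal.quot_surjective

lemma Q_nondegenerate : IsNondegenerate S.Q := .of_surjective S.Q_surjective

lemma j_nondegenerate : IsNondegenerate S.j := S.Q_nondegenerate.comp S.i_nondegenerate

lemma Q_s : Intertwines S.Q S.s S.t := ⟨fun _ => rfl, fun _ => rfl⟩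

lemma Q_i (a : A) :
    Intertwines S.Q (S.i a : 𝓜(ℂ, S.ToeplitzAlg)) (S.j a : 𝓜(ℂ, S.ExelProduct)) :=
  .coe S.Q (S.i a)

lemma t_mul_j (a : A) : S.t * (S.j a : 𝓜(ℂ, S.ExelProduct)) =
    (S.j (S.α a) : 𝓜(ℂ, S.ExelProduct)) * S.t := by
  have h := S.Q_s.mul (S.Q_i a)
  rw [show S.s * (S.i a : 𝓜(ℂ, S.ToeplitzAlg)) = (S.i (S.α a) : 𝓜(ℂ, S.ToeplitzAlg)) * S.s from
    S.toeplitzRep.covariant a] at h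
  exact h.unique S.Q_nondegenerate ((S.Q_i _).mul S.Q_s)

lemma star_t_mul_j_mul_t (a : A) : star S.t * (S.j a : 𝓜(ℂ, S.ExelProduct)) * S.t =
    (S.j (S.L a) : 𝓜(ℂ, S.ExelProduct)) := by
  have h := (S.Q_s.star.mul (S.Q_i a)).mul S.Q_s
  rw [show star S.s * (S.i a : 𝓜(ℂ, S.ToeplitzAlg)) * S.s =
    (S.i (S.L a) : 𝓜(ℂ, S.ToeplitzAlg)) from S.toeplitzRep.transfer a] at h
  exact h.unique S.Q_nondegenerate (S.Q_i _)

lemma j_mul_star_t (a : A) : (S.j a : 𝓜(ℂ, S.ExelProduct)) * star S.t =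
    star S.t * (S.j (S.α a) : 𝓜(ℂ, S.ExelProduct)) := by
  have h := congrArg star (S.t_mul_j (star a))
  simpa only [star_mul, star_coe, map_star, star_star] using h

/-- This is the transfer identity at the multiplier 1, and it is what makes t an isometry. -/
lemma L_alpha (a : A) : S.L (S.α a) = a := by
  obtain ⟨Lbar, -, -, h2, h3⟩ := S.transfer
  have := h2 a 1
  rw [h3] at this
  exact this

lemma star_t_mul_t : star S.t * S.t = 1 := by
  refine S.j_nondegenerate.eq_of_fst fun a => ?_
  apply coe_injective
  simp only [← mul_coe]
  rw [mul_assoc, S.t_mul_j, ← mul_assoc, S.star_t_mul_j_mul_t, S.L_alpha, one_mul]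

lemma t_pow_mul_j (i : ℕ) (a : A) : S.t ^ i * (S.j a : 𝓜(ℂ, S.ExelProduct)) =
    (S.j (S.α^[i] a) : 𝓜(ℂ, S.ExelProduct)) * S.t ^ i := by
  induction i with
  | zero => simp
  | succ i ih =>
    rw [pow_succ', mul_assoc, ih, ← mul_assoc, S.t_mul_j, mul_assoc, Function.iterate_succ_apply']

lemma generated_j_t :
    IsGeneratedBy (Set.range S.j ∪ Set.range fun a => S.t.snd (S.j a)) := by
  have h := S.generated_i_w.map S.Q_surjective
  rw [Set.image_union, ← Set.range_comp, ← Set.range_comp] at h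
  have e : S.Q ∘ S.w = fun a => S.t.snd (S.j a) := funext fun a => congrArg S.Q (S.s_snd a).symm
  rwa [e] at h

/-! ### The dual action -/

lemma dualAction_nondegenerate (z : Circle) : IsNondegenerate (S.dualAction z) := by
  refine IsNondegenerate.of_comp (π := S.j) ?_
  have : (S.dualAction z).comp S.j = S.j := by
    ext a
    exact S.dualAction_j z a
  rw [this]
  exact S.j_nondegenerate

lemma t_fst_j (a : A) : S.t.fst (S.j a) = S.t.snd (S.j (S.α a)) := by
  apply coe_injective
  simp only [← mul_coe, ← coe_mul, t_mul_j]

/-- The dual action is known on the elements j(a) and j(a)t only. Since t j(a) = j(α(a)) t, that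
determines it on t j(A), and nondegeneracy of j gives the rest. -/
lemma dualAction_t (z : Circle) : Intertwines (S.dualAction z) S.t ((z : ℂ) • S.t) := by
  refine S.j_nondegenerate.intertwines_of_comp (S.dualAction_nondegenerate z) fun a => ?_
  rw [t_fst_j, dualAction_jt, dualAction_j, DoubleCentralizer.smul_fst, smul_apply,
    t_fst_j]

/-- The element `j(a) tⁱ t*ᵏ j(b)`. -/
def mon (a b : A) (i k : ℕ) : S.ExelProduct := (S.t ^ i * star S.t ^ k).snd (S.j a) * S.j b

lemma coe_mon (a b : A) (i k : ℕ) : ((S.mon a b i k : S.ExelProduct) : 𝓜(ℂ, S.ExelProduct)) =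
    (S.j a : 𝓜(ℂ, S.ExelProduct)) * S.t ^ i * star S.t ^ k *
      (S.j b : 𝓜(ℂ, S.ExelProduct)) := by
  rw [mon, ← coe_mul_coe, ← coe_mul]
  simp only [mul_assoc]

lemma dualAction_t_pow (z : Circle) (i k : ℕ) : Intertwines (S.dualAction z)
    (S.t ^ i * star S.t ^ k)
    (((z : ℂ) ^ i * (starRingEnd ℂ z) ^ k) • (S.t ^ i * star S.t ^ k)) := by
  have h := ((S.dualAction_t z).pow i).mul ((S.dualAction_t z).star.pow k)
  rw [star_smul, smul_pow, smul_pow, smul_mul_assoc, mul_smul_comm, smul_smul] at h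
  exact h

lemma dualAction_mon (z : Circle) (a b : A) (i k : ℕ) : S.dualAction z (S.mon a b i k) =
    ((z : ℂ) ^ i * (starRingEnd ℂ z) ^ k) • S.mon a b i k := by
  rw [mon, map_mul, (S.dualAction_t_pow z i k).snd, dualAction_j, dualAction_j,
    DoubleCentralizer.smul_snd, smul_apply, smul_mul_assoc]

lemma coe_mul_conj (z : Circle) : (z : ℂ) * (starRingEnd ℂ z) = 1 := by
  rw [Complex.mul_conj, Circle.normSq_coe, Complex.ofReal_one]

lemma mon_mem_fixedPoints (a b : A) (i : ℕ) : S.mon a b i i ∈ S.fixedPoints := fun z => by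
  rw [dualAction_mon, ← mul_pow, coe_mul_conj, one_pow, one_smul]

/-! ### Spanning sets -/

/-- The span of the elements `j(a) tⁱ t*ᵏ j(b)`. -/
def monSpan : Submodule ℂ S.ExelProduct :=
  Submodule.span ℂ {x | ∃ a b i k, x = S.mon a b i k}

lemma mul_mem_closure_monSpan {y : S.ExelProduct}
    (h : ∀ a b i k, S.mon a b i k * y ∈ S.monSpan.topologicalClosure) {x : S.ExelProduct}
    (hx : x ∈ S.monSpan.topologicalClosure) : x * y ∈ S.monSpan.topologicalClosure := by
  have hcl : IsClosed ((S.monSpan.topologicalClosure.comap (LinearMap.mulRight ℂ y) :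
      Submodule ℂ S.ExelProduct) : Set S.ExelProduct) :=
    S.monSpan.isClosed_topologicalClosure.preimage (continuous_id.mul continuous_const)
  refine closure_minimal (Submodule.span_le.mpr ?_) hcl hx
  rintro _ ⟨a, b, i, k, rfl⟩
  exact h a b i k

lemma mon_mem_closure (a b : A) (i k : ℕ) : S.mon a b i k ∈ S.monSpan.topologicalClosure :=
  Submodule.le_topologicalClosure _ (Submodule.subset_span ⟨a, b, i, k, rfl⟩)

/-- Products that end in t are not of the form of `mon`; as x is the limit of x j(e), a factor from
j(A) may be appended. -/
lemma mem_closure_monSpan_of_mul_j {x : S.ExelProduct}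
    (h : ∀ c, x * S.j c ∈ S.monSpan.topologicalClosure) :
    x ∈ S.monSpan.topologicalClosure := by
  obtain ⟨l, hne, hb, hl, hr, hs⟩ := exists_selfAdjoint_approxUnit A
  exact S.monSpan.isClosed_topologicalClosure.mem_of_tendsto
    (S.j_nondegenerate.tendsto_mul' hb hs hl x) (.of_forall fun e => h e)

lemma mon_mul_j (a b c : A) (i k : ℕ) : S.mon a b i k * S.j c = S.mon a (b * c) i k := by
  rw [mon, mon, mul_assoc, ← map_mul]

/-- The new t* moves left through j(b) by j(b) t* = t* j(α(b)). -/
lemma mon_mul_star (a b c : A) (i k : ℕ) :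
    S.mon a b i k * star (S.t.snd (S.j c)) = S.mon a (S.α b * star c) i (k + 1) := by
  apply coe_injective
  simp only [← coe_mul_coe, coe_mon, ← star_coe, ← coe_mul, star_mul, map_mul, pow_succ, map_star]
  simp only [mul_assoc]
  rw [← mul_assoc (S.j b : 𝓜(ℂ, S.ExelProduct)), j_mul_star_t, mul_assoc]

/-- One t* is available to absorb the new t, by t* j(bc) t = j(L(bc)). -/
lemma mon_mul_t_succ (a b c d : A) (i k : ℕ) :
    S.mon a b i (k + 1) * S.t.snd (S.j c) * S.j d = S.mon a (S.L (b * c) * d) i k := by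
  apply coe_injective
  simp only [← coe_mul_coe, coe_mon, ← coe_mul, map_mul, pow_succ, ← star_t_mul_j_mul_t, mul_assoc]

/-- With no t* to absorb the new t, the coefficient between t^i and t moves to the left, by t^i
j(bc) = j(α^i(bc)) t^i. -/
lemma mon_mul_t_zero (a b c d : A) (i : ℕ) :
    S.mon a b i 0 * S.t.snd (S.j c) * S.j d = S.mon (a * S.α^[i] (b * c)) d (i + 1) 0 := by
  apply coe_injective
  simp only [← coe_mul_coe, coe_mon, ← coe_mul, map_mul, pow_succ, pow_zero, mul_one]
  have h := S.t_pow_mul_j i (b * c)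
  rw [map_mul, ← coe_mul_coe] at h
  simp only [mul_assoc] at h ⊢
  rw [← mul_assoc (S.j (S.α^[i] (b * c)) : 𝓜(ℂ, S.ExelProduct)), ← h]
  simp only [mul_assoc]

/-- The set K of all y with D y ⊆ D is a closed subalgebra. The three product formulas put the
generators and their adjoints into K, so K is everything and D is a right ideal. It contains j(A),
and j(A) contains an approximate unit for E. -/
lemma closure_monSpan : S.monSpan.topologicalClosure = ⊤ := by
  set D := S.monSpan.topologicalClosure with hD
  let K : Submodule ℂ S.ExelProduct :=
    { carrier := {y | ∀ x ∈ D, x * y ∈ D}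
      add_mem' := fun {y z} hy hz x hx => by
        rw [mul_add]; exact D.add_mem (hy x hx) (hz x hx)
      zero_mem' := fun x _ => by rw [mul_zero]; exact D.zero_mem
      smul_mem' := fun c y hy x hx => by
        rw [mul_smul_comm]; exact D.smul_mem c (hy x hx) }
  have hK : IsClosed (K : Set S.ExelProduct) := by
    have : (K : Set S.ExelProduct) = ⋂ x ∈ D, {y | x * y ∈ D} := by
      ext y; simp [K]
    rw [this]
    exact isClosed_biInter fun x _ =>
      S.monSpan.isClosed_topologicalClosure.preimage (continuous_const.mul continuous_id)
  have hj : ∀ a, S.j a ∈ K := fun c x hx =>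
    S.mul_mem_closure_monSpan (fun a b i k => by rw [mon_mul_j]; exact S.mon_mem_closure _ _ _ _) hx
  have htop : ∀ y, y ∈ K := by
    refine S.generated_j_t.induction K hK ?_ ?_ fun y hy z hz x hx => ?_
    · rintro _ (⟨c, rfl⟩ | ⟨c, rfl⟩)
      · exact hj c
      · refine fun x hx => S.mul_mem_closure_monSpan (fun a b i k =>
          S.mem_closure_monSpan_of_mul_j fun d => ?_) hx
        cases k with
        | zero => rw [mon_mul_t_zero]; exact S.mon_mem_closure _ _ _ _
        | succ k => rw [mon_mul_t_succ]; exact S.mon_mem_closure _ _ _ _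
    · rintro _ (⟨c, rfl⟩ | ⟨c, rfl⟩)
      · rw [← map_star]; exact hj _
      · exact fun x hx => S.mul_mem_closure_monSpan (fun a b i k => by
          rw [mon_mul_star]; exact S.mon_mem_closure _ _ _ _) hx
    · rw [← mul_assoc]; exact hz _ (hy x hx)
  refine top_le_iff.mp fun y _ => ?_
  obtain ⟨l, hne, hb, hl, hr, hs⟩ := exists_selfAdjoint_approxUnit A
  refine S.monSpan.isClosed_topologicalClosure.mem_of_tendsto
    (S.j_nondegenerate.tendsto_mul hb hl y) (.of_forall fun e => htop y _ ?_)
  -- j(e) is itself in D, because each j(e) j(d) is the monomial with both exponents 0.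
  refine S.mem_closure_monSpan_of_mul_j fun d => ?_
  have : S.j e * S.j d = S.mon e d 0 0 := by
    simp [mon]
  rw [this]
  exact S.mon_mem_closure _ _ _ _

/-- The average of `α̂_z(x)` over the `N`-th roots of unity `z`. -/
def average (N : ℕ) (x : S.ExelProduct) : S.ExelProduct :=
  (N : ℂ)⁻¹ • ∑ n ∈ Finset.range N, S.dualAction (Circle.exp (2 * Real.pi / N) ^ n) x

lemma average_add (N : ℕ) (x y : S.ExelProduct) :
    S.average N (x + y) = S.average N x + S.average N y := by
  simp only [average, map_add, Finset.sum_add_distrib, smul_add]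

lemma average_smul (N : ℕ) (c : ℂ) (x : S.ExelProduct) :
    S.average N (c • x) = c • S.average N x := by
  simp only [average, map_smul, ← Finset.smul_sum, smul_comm c]

lemma average_of_mem {N : ℕ} (hN : N ≠ 0) {x : S.ExelProduct} (hx : x ∈ S.fixedPoints) :
    S.average N x = x := by
  have h : ∀ z, S.dualAction z x = x := hx
  simp only [average, h, Finset.sum_const, Finset.card_range]
  rw [← Nat.cast_smul_eq_nsmul ℂ, smul_smul, inv_mul_cancel₀ (Nat.cast_ne_zero.mpr hN), one_smul]

lemma norm_average_le (N : ℕ) (x : S.ExelProduct) : ‖S.average N x‖ ≤ ‖x‖ := by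
  -- For N = 0 the average is 0, as an empty sum.
  rcases Nat.eq_zero_or_pos N with rfl | hN
  · simp [average]
  rw [average, norm_smul, norm_inv, Complex.norm_natCast,
    inv_mul_le_iff₀ (Nat.cast_pos.mpr hN)]
  refine (norm_sum_le _ _).trans ?_
  calc _ ≤ ∑ n ∈ Finset.range N, ‖x‖ :=
        Finset.sum_le_sum fun n _ => NonUnitalStarAlgHom.norm_apply_le _ _
    _ = _ := by simp

/-- The average is a geometric sum in ζ, an N-th root of unity. If ζ were 1 then ω^i = ω^k for a
primitive N-th root ω, which is impossible for distinct exponents below N; hence the bounds on i and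
k. -/
lemma average_mon_of_ne (a b : A) {i k N : ℕ} (h : i ≠ k) (hi : i < N) (hk : k < N) :
    S.average N (S.mon a b i k) = 0 := by
  have hN : N ≠ 0 := by omega
  set ω := Circle.exp (2 * Real.pi / N) with hω
  have hprim : IsPrimitiveRoot (ω : ℂ) N := by
    have := Complex.isPrimitiveRoot_exp N hN
    rw [hω, Circle.coe_exp]
    convert this using 2
    push_cast
    ring
  set ζ : ℂ := (ω : ℂ) ^ i * (starRingEnd ℂ ω) ^ k with hζ
  have hζ1 : ζ ≠ 1 := by
    intro h1
    have h2 : (ω : ℂ) ^ i = (ω : ℂ) ^ k := by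
      calc (ω : ℂ) ^ i = ζ * (ω : ℂ) ^ k := by
            rw [hζ, mul_assoc, ← mul_pow, mul_comm (starRingEnd ℂ _), coe_mul_conj, one_pow,
              mul_one]
        _ = _ := by rw [h1, one_mul]
    exact h (hprim.pow_inj hi hk h2)
  have hζN : ζ ^ N = 1 := by
    have : ζ ^ N = ((ω : ℂ) ^ N) ^ i * (starRingEnd ℂ ((ω : ℂ) ^ N)) ^ k := by
      rw [hζ, map_pow]; ring
    rw [this, hprim.pow_eq_one]
    simp
  have hterm : ∀ n, S.dualAction (ω ^ n) (S.mon a b i k) = ζ ^ n • S.mon a b i k := fun n => by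
    rw [dualAction_mon, hζ, Circle.coe_pow, map_pow]
    congr 1
    ring
  simp only [average, ← hω, hterm]
  rw [← Finset.sum_smul, geom_sum_eq hζ1, hζN, sub_self, zero_div, zero_smul, smul_zero]

/-- The span of the elements `j(a) tⁱ t*ⁱ j(b)` in the fixed-point algebra. -/
def fixedSpan : Submodule ℂ S.fixedPoints :=
  Submodule.span ℂ {x | ∃ a b i, (x : S.ExelProduct) = S.mon a b i i}

/-- Only finitely many exponents occur in x. Once N exceeds them all, averaging keeps exactly the
terms with equal exponents, so finite averages replace the integral over the circle. -/
lemma eventually_average_mem {x : S.ExelProduct} (hx : x ∈ S.monSpan) :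
    ∀ᶠ N in atTop, ∃ y ∈ S.fixedSpan, (y : S.ExelProduct) = S.average N x := by
  induction hx using Submodule.span_induction with
  | mem x hx =>
    obtain ⟨a, b, i, k, rfl⟩ := hx
    filter_upwards [eventually_gt_atTop (max i k)] with N hN
    by_cases h : i = k
    · subst h
      refine ⟨⟨_, S.mon_mem_fixedPoints a b i⟩, Submodule.subset_span ⟨a, b, i, rfl⟩, ?_⟩
      rw [S.average_of_mem (by omega) (S.mon_mem_fixedPoints a b i)]
    · refine ⟨0, S.fixedSpan.zero_mem, ?_⟩
      rw [S.average_mon_of_ne a b h (by omega) (by omega)]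
      rfl
  | zero =>
    refine .of_forall fun N => ⟨0, S.fixedSpan.zero_mem, ?_⟩
    simp [average]
  | add x y _ _ hx hy =>
    filter_upwards [hx, hy] with N ⟨x', hx', ex⟩ ⟨y', hy', ey⟩
    exact ⟨x' + y', S.fixedSpan.add_mem hx' hy', by rw [average_add, ← ex, ← ey]; rfl⟩
  | smul c x _ hx =>
    filter_upwards [hx] with N ⟨x', hx', ex⟩
    exact ⟨c • x', S.fixedSpan.smul_mem c hx', by rw [average_smul, ← ex]; rfl⟩

/-- Averaging fixes x and does not increase norms, so if y in `monSpan` is close to x then its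
average is equally close; for large N that average lies in `fixedSpan`. -/
lemma dense_fixedSpan : Dense (S.fixedSpan : Set S.fixedPoints) := fun x => by
  rw [Metric.mem_closure_iff]
  intro ε hε
  have hx : (x : S.ExelProduct) ∈ closure (S.monSpan : Set S.ExelProduct) := by
    have : (x : S.ExelProduct) ∈ S.monSpan.topologicalClosure := by
      rw [closure_monSpan]; trivial
    exact this
  obtain ⟨y, hy, hd⟩ := Metric.mem_closure_iff.mp hx ε hε
  obtain ⟨N, ⟨y', hy', e⟩, hN⟩ := ((S.eventually_average_mem hy).and (eventually_ne_atTop 0)).exists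
  refine ⟨y', hy', ?_⟩
  rw [Subtype.dist_eq, e, ← S.average_of_mem hN x.2, dist_eq_norm, sub_eq_add_neg,
    ← neg_one_smul ℂ, ← average_smul, ← average_add, neg_one_smul, ← sub_eq_add_neg]
  exact (S.norm_average_le N _).trans_lt (by rwa [← dist_eq_norm])

/-! ### The endomorphism of the fixed-point algebra -/

/-- The homomorphism `j` with values in the fixed-point algebra. -/
def jFixed : A →⋆ₙₐ[ℂ] S.fixedPoints :=
  NonUnitalStarAlgHom.codRestrict S.j S.fixedPoints fun a z => S.dualAction_j z a

lemma coe_jFixed (a : A) : (S.jFixed a : S.ExelProduct) = S.j a := rfl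

lemma fixedIncl_apply (x : S.fixedPoints) : S.fixedIncl x = x := rfl

lemma fixedIncl_nondegenerate : IsNondegenerate S.fixedIncl :=
  .of_comp (π := S.jFixed) S.j_nondegenerate

lemma fixedIncl_injective : Function.Injective S.fixedIncl := Subtype.val_injective

/-- Density is needed inside the fixed-point algebra, not only in E: the products j(e)x stay in the
subalgebra, and they converge there because it has the subspace topology. -/
lemma jFixed_nondegenerate : IsNondegenerate S.jFixed := fun x => by
  obtain ⟨l, hne, hb, hl, hr, hs⟩ := exists_selfAdjoint_approxUnit A
  have h : Tendsto (fun e => S.jFixed e * x) l (𝓝 x) :=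
    tendsto_subtype_rng.mpr (S.j_nondegenerate.tendsto_mul hb hl x)
  exact mem_closure_of_tendsto h (.of_forall fun e => Submodule.subset_span ⟨e, x, rfl⟩)

/-- The restriction to the fixed-point algebra of a multiplier that is fixed by the dual action. -/
def restrict (U : 𝓜(ℂ, S.ExelProduct)) (h : ∀ z, Intertwines (S.dualAction z) U U) :
    𝓜(ℂ, S.fixedPoints) where
  fst :=
    { toFun := fun x => ⟨U.fst x, fun z => by rw [(h z).fst, x.2 z]⟩
      map_add' := fun x y => Subtype.ext (map_add U.fst _ _)
      map_smul' := fun c x => Subtype.ext (map_smul U.fst c _)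
      cont := (U.fst.continuous.comp continuous_subtype_val).subtype_mk _ }
  snd :=
    { toFun := fun x => ⟨U.snd x, fun z => by rw [(h z).snd, x.2 z]⟩
      map_add' := fun x y => Subtype.ext (map_add U.snd _ _)
      map_smul' := fun c x => Subtype.ext (map_smul U.snd c _)
      cont := (U.snd.continuous.comp continuous_subtype_val).subtype_mk _ }
  central x y := Subtype.ext (U.central x y)

lemma fixedIncl_restrict (U : 𝓜(ℂ, S.ExelProduct))
    (h : ∀ z, Intertwines (S.dualAction z) U U) : Intertwines S.fixedIncl (S.restrict U h) U :=
  ⟨fun _ => rfl, fun _ => rfl⟩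

/-- The extension `M(F) → M(E)` of the inclusion of the fixed-point algebra. -/
def inclBar : 𝓜(ℂ, S.fixedPoints) →⋆ₙₐ[ℂ] 𝓜(ℂ, S.ExelProduct) :=
  S.fixedIncl_nondegenerate.extend

/-- Identities between multipliers of the fixed-point algebra can therefore be checked in M(E),
where t is available. -/
lemma inclBar_injective : Function.Injective S.inclBar :=
  S.fixedIncl_nondegenerate.extend_injective S.fixedIncl_injective

lemma inclBar_spec (m : 𝓜(ℂ, S.fixedPoints)) : Intertwines S.fixedIncl m (S.inclBar m) :=
  S.fixedIncl_nondegenerate.intertwines_extend m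

lemma inclBar_restrict (U : 𝓜(ℂ, S.ExelProduct))
    (h : ∀ z, Intertwines (S.dualAction z) U U) : S.inclBar (S.restrict U h) = U :=
  S.fixedIncl_nondegenerate.extend_eq (S.fixedIncl_restrict U h)

lemma inclBar_one : S.inclBar 1 = 1 :=
  S.fixedIncl_nondegenerate.extend_eq (.one _)

lemma inclBar_coe (x : S.fixedPoints) :
    S.inclBar (x : 𝓜(ℂ, S.fixedPoints)) = ((x : S.ExelProduct) : 𝓜(ℂ, S.ExelProduct)) :=
  S.fixedIncl_nondegenerate.extend_eq (.coe S.fixedIncl x)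

/-- It suffices to test on x in the fixed-point algebra, where both x and m x are invariant.
Conjugates of such multipliers by t are then invariant too and restrict again to the fixed-point
algebra. -/
lemma dualAction_inclBar (z : Circle) (m : 𝓜(ℂ, S.fixedPoints)) :
    Intertwines (S.dualAction z) (S.inclBar m) (S.inclBar m) := by
  refine S.fixedIncl_nondegenerate.intertwines_of_comp (S.dualAction_nondegenerate z) fun x => ?_
  rw [← (S.inclBar_spec m).fst, fixedIncl_apply, fixedIncl_apply, (m.fst x).2 z, x.2 z,
    ← fixedIncl_apply, ← fixedIncl_apply, (S.inclBar_spec m).fst]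

/-- The factor z from t cancels the conjugate factor from t*. -/
lemma dualAction_t_mul_star (z : Circle) {U : 𝓜(ℂ, S.ExelProduct)}
    (h : Intertwines (S.dualAction z) U U) :
    Intertwines (S.dualAction z) (S.t * U * star S.t) (S.t * U * star S.t) := by
  have h' := ((S.dualAction_t z).mul h).mul (S.dualAction_t z).star
  rw [star_smul, smul_mul_assoc, smul_mul_assoc, mul_smul_comm, smul_smul, Complex.star_def,
    coe_mul_conj, one_smul] at h'
  exact h'

lemma dualAction_star_t_mul (z : Circle) {U : 𝓜(ℂ, S.ExelProduct)}
    (h : Intertwines (S.dualAction z) U U) :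
    Intertwines (S.dualAction z) (star S.t * U * S.t) (star S.t * U * S.t) := by
  have h' := ((S.dualAction_t z).star.mul h).mul (S.dualAction_t z)
  rw [star_smul, smul_mul_assoc, smul_mul_assoc, mul_smul_comm, smul_smul, Complex.star_def,
    mul_comm (starRingEnd ℂ _), coe_mul_conj, one_smul] at h'
  exact h'

lemma mem_fixedPoints_of_intertwines {x : S.ExelProduct}
    (h : ∀ z, Intertwines (S.dualAction z) (x : 𝓜(ℂ, S.ExelProduct)) x) : x ∈ S.fixedPoints :=
  fun z => coe_injective ((h z).map_eq (S.dualAction_nondegenerate z))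

lemma intertwines_of_mem_fixedPoints {x : S.ExelProduct} (hx : x ∈ S.fixedPoints) (z : Circle) :
    Intertwines (S.dualAction z) (x : 𝓜(ℂ, S.ExelProduct)) x := by
  have := Intertwines.coe (S.dualAction z) x
  rwa [hx z] at this

lemma conj_t_mem {x : S.ExelProduct} (hx : x ∈ S.fixedPoints) : conj S.t x ∈ S.fixedPoints :=
  S.mem_fixedPoints_of_intertwines fun z => by
    rw [coe_conj]
    exact S.dualAction_t_mul_star z (S.intertwines_of_mem_fixedPoints hx z)

lemma conj_star_t_mem {x : S.ExelProduct} (hx : x ∈ S.fixedPoints) :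
    conj (star S.t) x ∈ S.fixedPoints :=
  S.mem_fixedPoints_of_intertwines fun z => by
    rw [coe_conj, star_star]
    exact S.dualAction_star_t_mul z (S.intertwines_of_mem_fixedPoints hx z)

/-- The endomorphism `x ↦ t x t*` of the fixed-point algebra. -/
def β : S.fixedPoints →⋆ₙₐ[ℂ] S.fixedPoints :=
  NonUnitalStarAlgHom.codRestrict ((conjHom S.t S.star_t_mul_t).comp S.fixedIncl) S.fixedPoints
    fun x => S.conj_t_mem x.2

lemma coe_β (x : S.fixedPoints) : (S.β x : S.ExelProduct) = conj S.t x := rfl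

lemma coe_coe_β (x : S.fixedPoints) : ((S.β x : S.ExelProduct) : 𝓜(ℂ, S.ExelProduct)) =
    S.t * ((x : S.ExelProduct) : 𝓜(ℂ, S.ExelProduct)) * star S.t := by
  rw [coe_β, coe_conj]

lemma β_injective : Function.Injective S.β := fun x y h => by
  have h' := congrArg (fun x : S.fixedPoints => conj (star S.t) (x : S.ExelProduct)) h
  simp only [coe_β, conj_star_conj S.t S.star_t_mul_t] at h'
  exact Subtype.ext h'

/-- The multiplier `t m t*` of the fixed-point algebra. -/
def βbarFun (m : 𝓜(ℂ, S.fixedPoints)) : 𝓜(ℂ, S.fixedPoints) :=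
  S.restrict (S.t * S.inclBar m * star S.t) fun z =>
    S.dualAction_t_mul_star z (S.dualAction_inclBar z m)

lemma inclBar_βbarFun (m : 𝓜(ℂ, S.fixedPoints)) :
    S.inclBar (S.βbarFun m) = S.t * S.inclBar m * star S.t :=
  S.inclBar_restrict _ _

/-- The extension of `β` to the multiplier algebra of the fixed-point algebra. -/
def βbar : 𝓜(ℂ, S.fixedPoints) →⋆ₙₐ[ℂ] 𝓜(ℂ, S.fixedPoints) where
  toFun := S.βbarFun
  map_smul' c m := S.inclBar_injective <| by
    simp only [MonoidHom.id_apply, inclBar_βbarFun, map_smul, smul_mul_assoc, mul_smul_comm]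
  map_zero' := S.inclBar_injective <| by
    simp only [inclBar_βbarFun, map_zero, mul_zero, zero_mul]
  map_add' m n := S.inclBar_injective <| by
    simp only [inclBar_βbarFun, map_add, mul_add, add_mul]
  map_mul' m n := S.inclBar_injective <| by
    simp only [inclBar_βbarFun, map_mul, mul_assoc]
    rw [← mul_assoc (star S.t) S.t, star_t_mul_t, one_mul]
  map_star' m := S.inclBar_injective <| by
    simp only [inclBar_βbarFun, map_star, star_mul, star_star, mul_assoc]

lemma inclBar_βbar (m : 𝓜(ℂ, S.fixedPoints)) :
    S.inclBar (S.βbar m) = S.t * S.inclBar m * star S.t := S.inclBar_βbarFun m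

lemma βbar_coe (x : S.fixedPoints) :
    S.βbar (x : 𝓜(ℂ, S.fixedPoints)) = (S.β x : 𝓜(ℂ, S.fixedPoints)) :=
  S.inclBar_injective <| by
    rw [inclBar_βbar, inclBar_coe, inclBar_coe, coe_coe_β]

/-- A positive element of the fixed-point algebra has a square root in it. -/
lemma exists_sqrt_mem (y : S.ExelProduct) (hy : y * star y ∈ S.fixedPoints) :
    ∃ d ∈ S.fixedPoints, y * star y = d * star d := by
  let _ := CStarAlgebra.spectralOrder S.ExelProduct
  let _ := CStarAlgebra.spectralOrderedRing S.ExelProduct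
  have h0 : 0 ≤ y * star y := mul_star_self_nonneg y
  have hd : 0 ≤ CFC.sqrt (y * star y) := CFC.sqrt_nonneg _
  refine ⟨CFC.sqrt (y * star y), fun z => ?_, ?_⟩
  · symm
    -- The image of the square root under the dual action is a positive square root of the same
    -- invariant element, so uniqueness of positive square roots shows that it is fixed.
    apply CFC.sqrt_unique
    · rw [← map_mul, CFC.sqrt_mul_sqrt_self _ h0, hy z]
    · obtain ⟨b, hb⟩ := CStarAlgebra.nonneg_iff_eq_star_mul_self.mp hd
      rw [hb, map_mul, map_star]
      exact star_mul_self_nonneg _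
  · rw [(IsSelfAdjoint.of_nonneg hd).star_eq, CFC.sqrt_mul_sqrt_self _ h0]

/-- `‖βbar(m) x‖ = ‖m d‖` with `d d* = t* x x* t`. -/
lemma exists_norm_βbar_fst (x : S.fixedPoints) :
    ∃ d : S.fixedPoints, ∀ m : 𝓜(ℂ, S.fixedPoints), ‖(S.βbar m).fst x‖ = ‖m.fst d‖ := by
  -- The vector t* x need not lie in the fixed-point algebra, so m cannot be tested on it there. But
  -- (t* x)(t* x)* = t* x x* t does lie in it, and d is the positive square root of that element.
  have hx : (star S.t).fst (x : S.ExelProduct) * star ((star S.t).fst (x : S.ExelProduct)) =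
      conj (star S.t) ((x * star x : S.fixedPoints) : S.ExelProduct) := by
    apply coe_injective
    have : ((x * star x : S.fixedPoints) : S.ExelProduct) =
      (x : S.ExelProduct) * star (x : S.ExelProduct) := rfl
    simp only [← coe_mul_coe, ← star_coe, ← mul_coe, coe_conj, this, star_mul, mul_assoc]
  obtain ⟨d, hd, e⟩ := S.exists_sqrt_mem _ (hx ▸ S.conj_star_t_mem (x * star x).2)
  refine ⟨⟨d, hd⟩, fun m => ?_⟩
  set y : S.ExelProduct := (((S.βbar m).fst x : S.fixedPoints) : S.ExelProduct) with hy
  set w : S.ExelProduct := ((m.fst ⟨d, hd⟩ : S.fixedPoints) : S.ExelProduct) with hw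
  have hy' : (y : 𝓜(ℂ, S.ExelProduct)) =
      S.t * S.inclBar m * (((star S.t).fst (x : S.ExelProduct) : S.ExelProduct) :
        𝓜(ℂ, S.ExelProduct)) := by
    rw [← mul_coe, hy, ← fixedIncl_apply, (S.inclBar_spec _).fst, ← mul_coe, inclBar_βbar,
      fixedIncl_apply]
    simp only [mul_assoc]
  have hw' : (w : 𝓜(ℂ, S.ExelProduct)) = S.inclBar m * (d : 𝓜(ℂ, S.ExelProduct)) := by
    rw [hw, ← fixedIncl_apply, (S.inclBar_spec _).fst, ← mul_coe]
    rfl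
  -- Here y = t m t* x and w = m d, so y y* = t m (t* x x* t) m* t* = t (m d d* m*) t*. Conjugation
  -- by t preserves norms, and the C⋆-identity gives ‖y‖ = ‖w‖.
  have key : y * star y = conj S.t (w * star w) := by
    apply coe_injective
    have e' := congrArg (fun a : S.ExelProduct => (a : 𝓜(ℂ, S.ExelProduct))) e
    simp only [← coe_mul_coe, ← star_coe] at e'
    simp only [← coe_mul_coe, ← star_coe, coe_conj, hy', hw', star_mul, mul_assoc] at e' ⊢
    rw [← mul_assoc (((star S.t).fst (x : S.ExelProduct) : S.ExelProduct) :
        𝓜(ℂ, S.ExelProduct)), e', mul_assoc]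
  have h := congrArg norm key
  rw [norm_conj S.t S.star_t_mul_t, CStarRing.norm_self_mul_star, CStarRing.norm_self_mul_star] at h
  exact (mul_self_inj (norm_nonneg _) (norm_nonneg _)).mp h

lemma continuous_of_dist_eq {X E : Type*} [TopologicalSpace X] [PseudoMetricSpace E] {f g : X → E}
    (hg : Continuous g) (h : ∀ a b, dist (f a) (f b) = dist (g a) (g b)) : Continuous f := by
  refine continuous_iff_continuousAt.mpr fun a => ?_
  rw [ContinuousAt, tendsto_iff_dist_tendsto_zero]
  simp only [h]
  exact tendsto_iff_dist_tendsto_zero.mp (hg.tendsto a)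

/-- Each strict seminorm of βbar(m) at x is a strict seminorm of m at another element of the
fixed-point algebra, so continuity holds one coordinate at a time. -/
lemma continuous_βbar :
    @Continuous _ _ (strictTopology S.fixedPoints) (strictTopology S.fixedPoints) S.βbar := by
  let _ : TopologicalSpace 𝓜(ℂ, S.fixedPoints) := strictTopology S.fixedPoints
  have hc : Continuous fun (m : 𝓜(ℂ, S.fixedPoints)) (a : S.fixedPoints) =>
    (m.fst a, m.snd a) := continuous_induced_dom
  refine continuous_induced_rng.mpr (continuous_pi fun x => ?_)
  obtain ⟨d, hd⟩ := S.exists_norm_βbar_fst x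
  obtain ⟨d', hd'⟩ := S.exists_norm_βbar_fst (star x)
  refine Continuous.prodMk ?_ ?_
  · refine continuous_of_dist_eq (g := fun m : 𝓜(ℂ, S.fixedPoints) => m.fst d)
      (continuous_fst.comp ((continuous_apply d).comp hc)) fun m n => ?_
    have := hd (m - n)
    rw [map_sub] at this
    simpa only [dist_eq_norm] using! this
  -- On the right, take adjoints: ‖x βbar(m)‖ = ‖βbar(m*) x*‖ = ‖m* d'‖ = ‖d'* m‖.
  · refine continuous_of_dist_eq (g := fun m : 𝓜(ℂ, S.fixedPoints) => m.snd (star d'))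
      (continuous_snd.comp ((continuous_apply (star d')).comp hc)) fun m n => ?_
    have := hd' (star (m - n))
    rw [map_star S.βbar, DoubleCentralizer.star_fst, DoubleCentralizer.star_fst, norm_star, norm_star,
      star_star, map_sub] at this
    simpa only [dist_eq_norm] using! this

lemma isStrictExtension_βbar : IsStrictExtension S.β S.βbar := ⟨S.continuous_βbar, S.βbar_coe⟩

lemma fixedIncl_βbar_one : Intertwines S.fixedIncl (S.βbar 1) (S.t * star S.t) := by
  have h := S.inclBar_spec (S.βbar 1)
  rwa [inclBar_βbar, inclBar_one, mul_one] at h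

/-- As t*t = 1, every β(x) is unchanged by compression with tt*; conversely tt* x tt* = β(t* x t),
and t* x t is invariant. -/
lemma range_β (y : S.ExelProduct) : (∃ x : S.fixedPoints, (S.β x : S.ExelProduct) = y) ↔
    ∃ x : S.fixedPoints, (y : 𝓜(ℂ, S.ExelProduct)) =
      S.t * star S.t * ((x : S.ExelProduct) : 𝓜(ℂ, S.ExelProduct)) * (S.t * star S.t) := by
  constructor
  · rintro ⟨x, rfl⟩
    refine ⟨S.β x, ?_⟩
    rw [coe_coe_β]
    simp only [mul_assoc]
    rw [← mul_assoc (star S.t) S.t, star_t_mul_t, one_mul, ← mul_assoc (star S.t) S.t,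
      star_t_mul_t, one_mul]
  · rintro ⟨x, hx⟩
    refine ⟨⟨_, S.conj_star_t_mem x.2⟩, ?_⟩
    apply coe_injective
    simp only [hx, coe_coe_β, coe_conj, star_star, mul_assoc]

/-- The outer t and t* pass through the coefficients by t j(a) = j(α(a)) t and its adjoint. -/
lemma coe_β_mon (a b : A) (i : ℕ) :
    ((S.β ⟨_, S.mon_mem_fixedPoints a b i⟩ : S.ExelProduct) : 𝓜(ℂ, S.ExelProduct)) =
      (S.j (S.α a) : 𝓜(ℂ, S.ExelProduct)) * S.t ^ (i + 1) * star S.t ^ (i + 1) *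
        (S.j (S.α b) : 𝓜(ℂ, S.ExelProduct)) := by
  rw [coe_coe_β, coe_mon, pow_succ', pow_succ]
  simp only [mul_assoc]
  rw [j_mul_star_t, ← mul_assoc S.t, t_mul_j, mul_assoc]

/-- The Stacey-covariant representation `(id, t)`. -/
def staceyRep : StaceyRep S.β S.ExelProduct where
  π := S.fixedIncl
  nondegenerate := S.fixedIncl_nondegenerate
  V := S.t
  isometry := S.star_t_mul_t
  covariant x := S.coe_coe_β x

end ExelSystem

/-- In this form x enters only through a product with a fixed element, so limits along an
approximate unit can be taken. -/
lemma conj_mul {A : Type*} [NonUnitalCStarAlgebra A] (V : 𝓜(ℂ, A)) (x y : A) :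
    conj V x * y = V.fst (x * (star V).fst y) := by
  rw [conj, ← fst_mul, (star V).central]

lemma StaceyRep.π_iterate {B D : Type*} [NonUnitalCStarAlgebra B] [NonUnitalCStarAlgebra D]
    {β : B →⋆ₙₐ[ℂ] B} (ρ : StaceyRep β D) (i : ℕ) (b : B) :
    ρ.π (β^[i] b) = conj (ρ.V ^ i) (ρ.π b) := by
  apply coe_injective
  simp only [coe_conj, star_pow]
  induction i with
  | zero => simp
  | succ i ih =>
    rw [Function.iterate_succ_apply', ρ.covariant, ih, pow_succ', pow_succ]
    simp only [mul_assoc]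

/-! ### The universal property: from Stacey-covariant representations of the fixed-point algebra to
homomorphisms of the Exel crossed product. -/

namespace ExelSystem

variable {A : Type u} [NonUnitalCStarAlgebra A] (S : ExelSystem A)

/-- The multiplier `tⁱ t*ⁱ` of the fixed-point algebra. -/
def proj (i : ℕ) : 𝓜(ℂ, S.fixedPoints) :=
  S.restrict (S.t ^ i * star S.t ^ i) fun z => by
    have h := S.dualAction_t_pow z i i
    rwa [← mul_pow, coe_mul_conj, one_pow, one_smul] at h

lemma inclBar_proj (i : ℕ) : S.inclBar (S.proj i) = S.t ^ i * star S.t ^ i :=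
  S.inclBar_restrict _ _

section Representation

variable {D : Type u} [NonUnitalCStarAlgebra D] (ρ : StaceyRep S.β D)

/-- The elements β^i(j(e)) = t^i j(e) t*^i converge strictly to t^i t*^i, and their images V^i
π(j(e)) V*^i converge strictly to V^i V*^i, both because j(e) acts as an approximate unit. -/
lemma stacey_proj (i : ℕ) : Intertwines ρ.π (S.proj i) (ρ.V ^ i * star ρ.V ^ i) := by
  obtain ⟨l, hne, hb, hl, hr, hs⟩ := exists_selfAdjoint_approxUnit A
  refine intertwines_of_tendsto ρ.nondegenerate (l := l) (w := fun e => S.β^[i] (S.jFixed e))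
    (fun x => ?_) fun y => ?_
  · refine tendsto_subtype_rng.mpr ?_
    have h : ∀ e, ((S.β^[i] (S.jFixed e) * x : S.fixedPoints) : S.ExelProduct) =
        (S.t ^ i).fst (S.j e * (star (S.t ^ i)).fst x) := fun e => by
      rw [← conj_mul]
      -- The formula for iterates is applied here to the representation (id, t) itself.
      exact congrArg (· * (x : S.ExelProduct)) (S.staceyRep.π_iterate i (S.jFixed e))
    simp only [h]
    have := ((S.t ^ i).fst.continuous.tendsto _).comp
      (S.j_nondegenerate.tendsto_mul hb hl ((star (S.t ^ i)).fst x))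
    rw [star_pow] at this ⊢
    exact this
  · simp only [ρ.π_iterate, conj_mul]
    have := ((ρ.V ^ i).fst.continuous.tendsto _).comp
      ((ρ.nondegenerate.comp S.jFixed_nondegenerate).tendsto_mul hb hl ((star (ρ.V ^ i)).fst y))
    rw [star_pow] at this ⊢
    exact this

/-- In M(F) the monomial is the product of j(a), the projection t^i t*^i and j(b), and π is known on
each factor. -/
lemma stacey_mon (a b : A) (i : ℕ) :
    (ρ.π ⟨_, S.mon_mem_fixedPoints a b i⟩ : 𝓜(ℂ, D)) =
      (ρ.π (S.jFixed a) : 𝓜(ℂ, D)) * ρ.V ^ i * star ρ.V ^ i *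
        (ρ.π (S.jFixed b) : 𝓜(ℂ, D)) := by
  refine Intertwines.map_eq ρ.nondegenerate ?_
  have h := ((Intertwines.coe ρ.π (S.jFixed a)).mul (S.stacey_proj ρ i)).mul
    (Intertwines.coe ρ.π (S.jFixed b))
  simp only [mul_assoc] at h ⊢
  convert h
  apply S.inclBar_injective
  simp only [map_mul, inclBar_coe, inclBar_proj, coe_mon, coe_jFixed, mul_assoc]

/-- In the fixed-point algebra, β(j(a)) = j(α(a)) tt*. Applying π gives V π(j(a)) V* = π(j(α(a))) V
V*; multiply on the right by V. -/
lemma stacey_covariant (a : A) : ρ.V * (ρ.π (S.jFixed a) : 𝓜(ℂ, D)) =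
    (ρ.π (S.jFixed (S.α a)) : 𝓜(ℂ, D)) * ρ.V := by
  have h1 : (S.β (S.jFixed a) : 𝓜(ℂ, S.fixedPoints)) =
      (S.jFixed (S.α a) : 𝓜(ℂ, S.fixedPoints)) * S.proj 1 := by
    apply S.inclBar_injective
    simp only [map_mul, inclBar_coe, inclBar_proj, coe_coe_β, coe_jFixed, pow_one, t_mul_j,
      mul_assoc]
  have h2 := (Intertwines.coe ρ.π (S.jFixed (S.α a))).mul (S.stacey_proj ρ 1)
  rw [← h1] at h2
  have h3 := congrArg (· * ρ.V) (h2.map_eq ρ.nondegenerate)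
  simp only [ρ.covariant, pow_one, mul_assoc, ρ.isometry, mul_one] at h3
  exact h3

/-- The element β(j(L(a))) is tt* j(a) tt*. Applying π gives V π(j(L(a))) V* = V V* π(j(a)) V V*;
compress by V. -/
lemma stacey_transfer (a : A) : star ρ.V * (ρ.π (S.jFixed a) : 𝓜(ℂ, D)) * ρ.V =
    (ρ.π (S.jFixed (S.L a)) : 𝓜(ℂ, D)) := by
  have h1 : (S.β (S.jFixed (S.L a)) : 𝓜(ℂ, S.fixedPoints)) =
      S.proj 1 * (S.jFixed a : 𝓜(ℂ, S.fixedPoints)) * S.proj 1 := by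
    apply S.inclBar_injective
    simp only [map_mul, inclBar_coe, inclBar_proj, coe_coe_β, coe_jFixed, pow_one,
      ← star_t_mul_j_mul_t, mul_assoc]
  have h2 := ((S.stacey_proj ρ 1).mul (Intertwines.coe ρ.π (S.jFixed a))).mul (S.stacey_proj ρ 1)
  rw [← h1] at h2
  have h3 := congrArg (fun m => star ρ.V * (m * ρ.V)) (h2.map_eq ρ.nondegenerate)
  simp only [ρ.covariant, pow_one, mul_assoc, ρ.isometry, mul_one] at h3
  rw [← mul_assoc, ← mul_assoc (star ρ.V) ρ.V, ρ.isometry, one_mul, one_mul] at h3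
  rw [h3, mul_assoc]

/-- The Toeplitz-covariant representation `(π ∘ j, V)` given by a Stacey-covariant representation
`(π, V)` of the fixed-point algebra. -/
def toeplitzOfStacey : ToeplitzRep S D where
  π := ρ.π.comp S.jFixed
  nondegenerate := ρ.nondegenerate.comp S.jFixed_nondegenerate
  V := ρ.V
  covariant := S.stacey_covariant ρ
  transfer := S.stacey_transfer ρ

/-- The graph of `ρ.π` in `E × D`. -/
def piGraph : S.fixedPoints →ₗ[ℂ] S.ExelProduct × D where
  toFun x := (x, ρ.π x)
  map_add' x y := Prod.ext rfl (map_add ρ.π x y)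
  map_smul' c x := Prod.ext rfl (map_smul ρ.π c x)

/-- As π is contractive, x ↦ (x, π(x)) is isometric for the maximum norm, and the fixed-point
algebra is complete. -/
lemma isClosed_range_piGraph : IsClosed (LinearMap.range (S.piGraph ρ) : Set (S.ExelProduct × D)) := by
  have hiso : Isometry (S.piGraph ρ) := AddMonoidHomClass.isometry_of_norm _ fun x =>
    max_eq_left (NonUnitalStarAlgHom.norm_apply_le ρ.π x)
  rw [LinearMap.coe_range]
  exact hiso.isClosedEmbedding.isClosed_range

/-- For y in the range of (ψ_s, i)^(1), the image Q(y) lies in the fixed-point algebra and the lift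
of y is π(Q(y)). The graph of π is a closed subspace, so it is enough to treat ψ_s(m) ψ_s(n)*. -/
lemma mem_piGraph_of_compactGraph (p : (S.ML →L[ℂ] S.ML) × S.ToeplitzAlg)
    (hp : p ∈ S.compactGraph) :
    (S.Q p.2, S.lift (S.toeplitzOfStacey ρ) p.2) ∈ LinearMap.range (S.piGraph ρ) := by
  set G := LinearMap.range (S.piGraph ρ)
  let f : S.ToeplitzAlg → S.ExelProduct × D := fun y => (S.Q y, S.lift (S.toeplitzOfStacey ρ) y)
  have hf : Continuous f := (continuous_hom _).prodMk (continuous_hom _)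
  let K : Submodule ℂ ((S.ML →L[ℂ] S.ML) × S.ToeplitzAlg) :=
    { carrier := {p | f p.2 ∈ G}
      add_mem' := fun {p q} hp hq => by
        have := G.add_mem hp hq
        simpa only [f, Set.mem_ofPred_eq, Prod.snd_add, map_add] using! this
      zero_mem' := by
        simpa only [f, Set.mem_ofPred_eq, Prod.snd_zero, map_zero] using! G.zero_mem
      smul_mem' := fun c p hp => by
        have := G.smul_mem c hp
        simpa only [f, Set.mem_ofPred_eq, Prod.smul_snd, map_smul] using! this }
  have hG := S.isClosed_range_piGraph ρ
  have hK : IsClosed (K : Set ((S.ML →L[ℂ] S.ML) × S.ToeplitzAlg)) :=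
    hG.preimage (hf.comp continuous_snd)
  refine closure_minimal (Submodule.span_le.mpr ?_) hK hp
  rintro _ ⟨m, n, rfl⟩
  change f (S.ψ m * star (S.ψ n)) ∈ G
  -- By density of q(A), m = q(a) and n = q(b); then y = i(a) s s* i(b)*, whose image in E is the
  -- monomial j(a) tt* j(b*).
  refine S.denseRange_q.induction_on₂ (p := fun m n => f (S.ψ m * star (S.ψ n)) ∈ G)
    (hG.preimage (hf.comp (by fun_prop))) (fun a b => ?_) m n
  refine ⟨⟨_, S.mon_mem_fixedPoints a (star b) 1⟩, Prod.ext ?_ ?_⟩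
  · change S.mon a (star b) 1 1 = S.Q (S.ψ (S.q a) * star (S.ψ (S.q b)))
    have hw : ∀ c, S.Q (S.w c) = S.t.snd (S.j c) := fun c => congrArg S.Q (S.s_snd c).symm
    apply coe_injective
    simp only [ψ_q, map_mul, map_star, hw, coe_mon, pow_one, ← coe_mul_coe, ← star_coe, ← coe_mul,
      star_mul, mul_assoc]
  · change ρ.π ⟨_, S.mon_mem_fixedPoints a (star b) 1⟩ =
      S.lift (S.toeplitzOfStacey ρ) (S.ψ (S.q a) * star (S.ψ (S.q b)))
    apply coe_injective
    have hπ : ∀ c, (S.toeplitzOfStacey ρ).π c = ρ.π (S.jFixed c) := fun c => rfl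
    have hV : (S.toeplitzOfStacey ρ).V = ρ.V := rfl
    simp only [stacey_mon, ψ_q, map_mul, map_star, lift_w, pow_one, ← coe_mul_coe, ← star_coe,
      ToeplitzRep.coe_w, star_mul, mul_assoc, hπ, hV]

/-- The kernel of the lift is a closed ideal, so only the relations i(a) - y matter. In E one has
Q(y) = j(a), hence the lift of y is π(Q(y)) = π(j(a)), which is also the lift of i(a). -/
lemma lift_eq_zero_of_mem (x : S.ToeplitzAlg) (hx : x ∈ S.exelIdeal.carrier) :
    S.lift (S.toeplitzOfStacey ρ) x = 0 := by
  let J : ClosedIdeal S.ToeplitzAlg :=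
    { carrier := {x | S.lift (S.toeplitzOfStacey ρ) x = 0}
      add_mem' := fun {x y} (hx : _ = _) (hy : _ = _) => by
        change S.lift _ (x + y) = 0
        rw [map_add, hx, hy, add_zero]
      zero_mem' := map_zero _
      smul_mem' := fun c x (hx : _ = _) => by
        change S.lift _ (c • x) = 0
        rw [map_smul, hx, smul_zero]
      mul_mem_left' := fun x y (hy : _ = _) => by
        change S.lift _ (x * y) = 0
        rw [map_mul, hy, mul_zero]
      mul_mem_right' := fun x y (hx : _ = _) => by
        change S.lift _ (x * y) = 0
        rw [map_mul, hx, zero_mul]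
      star_mem' := fun x (hx : _ = _) => by
        change S.lift _ (star x) = 0
        rw [map_star, hx, star_zero]
      isClosed' := isClosed_eq (continuous_hom _) continuous_const }
  refine hx J ?_
  rintro _ ⟨a, ha, y, hy, rfl⟩
  change S.lift _ (S.i a - y) = 0
  obtain ⟨f, hf⟩ := S.mem_piGraph_of_compactGraph ρ _ hy
  have hf1 : (f : S.ExelProduct) = S.Q y := congrArg Prod.fst hf
  have hf2 : ρ.π f = S.lift (S.toeplitzOfStacey ρ) y := congrArg Prod.snd hf
  have hQ : S.Q (S.i a - y) = 0 :=
    (S.exelIdeal.quot_eq_zero_iff _).mpr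
      (ClosedIdeal.subset_generatedBy _ ⟨a, ha, y, hy, rfl⟩)
  rw [map_sub, sub_eq_zero] at hQ
  have : f = S.jFixed a := Subtype.ext (hf1.trans hQ.symm)
  rw [map_sub, ← hf2, this, lift_i]
  exact sub_self _

/-- The homomorphism on the Exel crossed product induced by a Stacey-covariant representation of
the fixed-point algebra. -/
def integrated : S.ExelProduct →⋆ₙₐ[ℂ] D :=
  S.exelIdeal.lift (S.lift (S.toeplitzOfStacey ρ)) (S.lift_eq_zero_of_mem ρ)

lemma integrated_j (a : A) : S.integrated ρ (S.j a) = ρ.π (S.jFixed a) :=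
  S.lift_i (S.toeplitzOfStacey ρ) a

lemma integrated_nondegenerate : IsNondegenerate (S.integrated ρ) := by
  refine IsNondegenerate.of_comp (π := S.j) ?_
  have : (S.integrated ρ).comp S.j = ρ.π.comp S.jFixed := by
    ext a
    exact S.integrated_j ρ a
  rw [this]
  exact ρ.nondegenerate.comp S.jFixed_nondegenerate

/-- On j(a) both sides equal π(j(α(a))) V, by the two covariance relations; nondegeneracy of j
extends this to E. -/
lemma integrated_t : Intertwines (S.integrated ρ) S.t ρ.V := by
  refine S.j_nondegenerate.intertwines_of_comp (S.integrated_nondegenerate ρ) fun a => ?_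
  have h : S.t.snd (S.j (S.α a)) = S.Q (S.w (S.α a)) := congrArg S.Q (S.s_snd _)
  have h' : S.integrated ρ (S.Q (S.w (S.α a))) = (S.toeplitzOfStacey ρ).w (S.α a) :=
    S.lift_w (S.toeplitzOfStacey ρ) (S.α a)
  rw [t_fst_j, h, h', integrated_j]
  apply coe_injective
  simp only [← mul_coe, stacey_covariant, ToeplitzRep.coe_w]
  rfl

/-- The construction used π only through π ∘ j and V. That it recovers all of π follows from
`stacey_mon` on the monomials j(a) t^i t*^i j(b) and the density of their span. -/
lemma integrated_fixed (x : S.fixedPoints) : S.integrated ρ x = ρ.π x := by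
  have hcl : IsClosed {x : S.fixedPoints | S.integrated ρ x = ρ.π x} :=
    isClosed_eq ((continuous_hom (S.integrated ρ)).comp continuous_subtype_val)
      (continuous_hom ρ.π)
  let K : Submodule ℂ S.fixedPoints :=
    { carrier := {x | S.integrated ρ x = ρ.π x}
      add_mem' := fun {x y} (hx : _ = _) (hy : _ = _) => by
        change S.integrated ρ (x + y) = ρ.π (x + y)
        rw [map_add, map_add, hx, hy]
      zero_mem' := (map_zero (S.integrated ρ)).trans (map_zero ρ.π).symm
      smul_mem' := fun c x (hx : _ = _) => by
        change S.integrated ρ (c • (x : S.ExelProduct)) = ρ.π (c • x)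
        rw [map_smul, map_smul, hx] }
  refine closure_minimal (Submodule.span_le.mpr ?_ : _ ≤ K) hcl (S.dense_fixedSpan x)
  rintro y ⟨a, b, i, hy⟩
  obtain rfl : y = ⟨_, S.mon_mem_fixedPoints a b i⟩ := Subtype.ext hy
  change S.integrated ρ (S.mon a b i i) = ρ.π ⟨_, S.mon_mem_fixedPoints a b i⟩
  apply coe_injective
  have hj : ∀ c, Intertwines (S.integrated ρ) (S.j c : 𝓜(ℂ, S.ExelProduct))
      (ρ.π (S.jFixed c) : 𝓜(ℂ, D)) := fun c => by
    rw [← integrated_j]; exact .coe _ _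
  have h := (((hj a).mul ((S.integrated_t ρ).pow i)).mul ((S.integrated_t ρ).star.pow i)).mul (hj b)
  rw [← coe_mon] at h
  simp only [h.map_eq (S.integrated_nondegenerate ρ), stacey_mon]

end Representation

/-- Generation is inherited from j(A) and j(A)t, since j(A) lies in the fixed-point algebra. -/
lemma isCrossedProduct_staceyRep : S.staceyRep.IsCrossedProduct := by
  refine ⟨S.generated_j_t.mono (Set.union_subset_union ?_ ?_), fun D _ ρ =>
    ⟨S.integrated ρ, S.integrated_nondegenerate ρ, S.integrated_fixed ρ, (S.integrated_t ρ).fst⟩⟩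
  · rintro _ ⟨a, rfl⟩
    exact ⟨S.jFixed a, rfl⟩
  · rintro _ ⟨a, rfl⟩
    exact ⟨S.jFixed a, rfl⟩

end ExelSystem

/-- Any two crossed products are canonically isomorphic. -/
lemma StaceyRep.IsCrossedProduct.exists_equiv {B C E : Type u} [NonUnitalCStarAlgebra B]
    [NonUnitalCStarAlgebra C] [NonUnitalCStarAlgebra E] {β : B →⋆ₙₐ[ℂ] B} {ι : StaceyRep β C}
    {κ : StaceyRep β E} (hι : ι.IsCrossedProduct) (hκ : κ.IsCrossedProduct) :
    ∃ Φ : C ≃⋆ₐ[ℂ] E, (∀ b, Φ (ι.π b) = κ.π b) ∧ ∀ c, Φ (ι.V.fst c) = κ.V.fst (Φ c) := by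
  -- Stated for arbitrary C and E so that it serves for both composites: each fixes the generators,
  -- hence is the identity.
  have inv : ∀ {C E : Type u} [NonUnitalCStarAlgebra C] [NonUnitalCStarAlgebra E]
      {ι : StaceyRep β C} {κ : StaceyRep β E} (_ : ι.IsCrossedProduct)
      (Φ : C →⋆ₙₐ[ℂ] E) (Ψ : E →⋆ₙₐ[ℂ] C), (∀ b, Φ (ι.π b) = κ.π b) → (∀ b, Ψ (κ.π b) = ι.π b) →
      Intertwines Φ ι.V κ.V → Intertwines Ψ κ.V ι.V → Ψ.comp Φ = NonUnitalStarAlgHom.id ℂ C := by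
    intro C E _ _ ι κ hι Φ Ψ h1 h2 h3 h4
    refine hι.1.hom_ext ?_
    rintro _ (⟨b, rfl⟩ | ⟨b, rfl⟩)
    · change Ψ (Φ (ι.π b)) = ι.π b
      rw [h1, h2]
    · change Ψ (Φ (ι.V.snd (ι.π b))) = ι.V.snd (ι.π b)
      rw [h3.snd, h4.snd, h1, h2]
  obtain ⟨Φ, hΦ, h1, h3⟩ := hι.2 E κ
  obtain ⟨Ψ, hΨ, h2, h4⟩ := hκ.2 C ι
  -- The generators i_B(b)v involve right multiplication by v; nondegeneracy supplies that half of
  -- the intertwining relation.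
  have e1 := inv hι Φ Ψ h1 h2 (hΦ.intertwines h3) (hΨ.intertwines h4)
  have e2 := inv hκ Ψ Φ h2 h1 (hΨ.intertwines h4) (hΦ.intertwines h3)
  exact ⟨StarAlgEquiv.ofBijective Φ ⟨Function.LeftInverse.injective (g := Ψ) fun x =>
    congrArg (fun f : C →⋆ₙₐ[ℂ] C => f x) e1, Function.RightInverse.surjective (g := Ψ) fun x =>
    congrArg (fun f : E →⋆ₙₐ[ℂ] E => f x) e2⟩, h1, h3⟩

end CrossedProduct
end

open CrossedProduct
-- The equation βbar(1) = tt* compares multipliers of different algebras, so it is expressed through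
-- their left and right actions on the fixed-point algebra. The last clause first identifies (id, t)
-- as a Stacey crossed product, which also shows that one exists, and then compares it with any
-- other.
theorem corollary4p1 {A : Type u} [NonUnitalCStarAlgebra A] (S : ExelSystem A) :
    ∃ β : S.fixedPoints →⋆ₙₐ[ℂ] S.fixedPoints,
      Function.Injective β ∧
      (∀ (a b : A) (i : ℕ), ∃ x : S.fixedPoints,
        ((x : S.ExelProduct) : 𝓜(ℂ, S.ExelProduct)) =
          (S.j a : 𝓜(ℂ, S.ExelProduct)) * S.t ^ i * star S.t ^ i *
            (S.j b : 𝓜(ℂ, S.ExelProduct)) ∧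
        ((β x : S.ExelProduct) : 𝓜(ℂ, S.ExelProduct)) =
          (S.j (S.α a) : 𝓜(ℂ, S.ExelProduct)) * S.t ^ (i + 1) * star S.t ^ (i + 1) *
            (S.j (S.α b) : 𝓜(ℂ, S.ExelProduct))) ∧
      (∃ βbar : 𝓜(ℂ, S.fixedPoints) →⋆ₙₐ[ℂ] 𝓜(ℂ, S.fixedPoints),
        IsStrictExtension β βbar ∧
        ∀ x : S.fixedPoints,
          (((βbar 1).fst x : S.fixedPoints) : S.ExelProduct) = (S.t * star S.t).fst x ∧
          (((βbar 1).snd x : S.fixedPoints) : S.ExelProduct) = (S.t * star S.t).snd x) ∧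
      (∀ y : S.ExelProduct, (∃ x : S.fixedPoints, (β x : S.ExelProduct) = y) ↔
        ∃ x : S.fixedPoints, (y : 𝓜(ℂ, S.ExelProduct)) =
          S.t * star S.t * ((x : S.ExelProduct) : 𝓜(ℂ, S.ExelProduct)) * (S.t * star S.t)) ∧
      ∃ ρ : StaceyRep β S.ExelProduct, ρ.π = S.fixedIncl ∧ ρ.V = S.t ∧
        ρ.IsCrossedProduct ∧
        ∀ (C : Type u) [NonUnitalCStarAlgebra C] (ι : StaceyRep β C), ι.IsCrossedProduct →
          ∃ Φ : C ≃⋆ₐ[ℂ] S.ExelProduct, (∀ x, Φ (ι.π x) = x) ∧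
            ∀ c, Φ (ι.V.fst c) = S.t.fst (Φ c) := by
  refine ⟨S.β, S.β_injective, fun a b i => ⟨⟨_, S.mon_mem_fixedPoints a b i⟩, S.coe_mon a b i i,
    S.coe_β_mon a b i⟩, ⟨S.βbar, S.isStrictExtension_βbar, fun x =>
    ⟨S.fixedIncl_βbar_one.fst x, S.fixedIncl_βbar_one.snd x⟩⟩, S.range_β, S.staceyRep, rfl, rfl,
    S.isCrossedProduct_staceyRep, fun C _ ι hι => hι.exists_equiv S.isCrossedProduct_staceyRep⟩
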